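/- **Theorem 1 (Pontryagin maximum principle for optimal sampled-data control problems).** Let $n,m,j$ be nonzero natural numbers, let $T>0$, and write $E(t)$ for the integer part of a real number $t$. Let $f:\mathbb R\times\mathbb R^n\times\mathbb R^m\to\mathbb R^n$ and $f^0:\mathbb R\times\mathbb R^n\times\mathbb R^m\to\mathbb R$ be continuous and of class $C^1$ in $(q,u)$ (the differential with respect to $(q,u)$ exists everywhere and is continuous in $(t,q,u)$), let $g:\mathbb R^n\times\mathbb R^n\to\mathbb R^j$ be of class $C^1$, and let $\Omega\subset\mathbb R^m$ and $S\subset\mathbb R^j$ be non-empty, closed and convex. Consider the problem of minimizing $$\int_0^{t_f} f^0\big(\tau,q(\tau),u(k(\tau)T)\big)\,d\tau ,\qquad k(\tau)=E(\tau/T),$$ over all final times $t_f\ge 0$ (either prescribed or left free), all sampled-data controls $u$ with $u(kT)\in\Omega$ for every $k\in\mathbb N$, and all absolutely continuous $q:[0,t_f]\to\mathbb R^n$ such that $\dot q(t)=f(t,q(t),u(k(t)T))$ for almost every $t\in[0,t_f)$ and $g(q(0),q(t_f))\in S$. Set $$H(t,q,p,p^0,u)=\langle p,f(t,q,u)\rangle+p^0f^0(t,q,u).$$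 If a trajectory $q^*$ on $[0,t_f^*]$, associated with a sampled-data control $u^*$, is an optimal solution of this problem, then there exist an absolutely continuous $p:[0,t_f^*]\to\mathbb R^n$ and a real number $p^0\le 0$, with $(p,p^0)$ not identically zero, such that all of the following hold. - *Extremal equations.* For almost every $t\in[0,t_f^*)$, with $k(t)=E(t/T)$, $$\dot q^*(t)=\frac{\partial H}{\partial p}\big(t,q^*(t),p(t),p^0,u^*(k(t)T)\big),\qquad \dot p(t)=-\frac{\partial H}{\partial q}\big(t,q^*(t),p(t),p^0,u^*(k(t)T)\big).$$ - *Maximization condition.* For every $k\in\mathbb N$ with $kT<t_f^*$ and every $y\in\Omega$, $$\Big\langle \int_{kT}^{\min((k+1)T,\,t_f^*)}\frac{\partial H}{\partial u}\big(\tau,q^*(\tau),p(\tau),p^0,u^*(kT)\big)\,d\tau,\ y-u^*(kT)\Big\rangle\le 0 .$$ - *Transversality conditions on the adjoint vector.* If the differential of $g$ at $(q^*(0),q^*(t_f^*))$ is surjective, then there is $\psi\in\mathbb R^j$ with $\langle -\psi,\,x-g(q^*(0),q^*(t_f^*))\rangle\le 0$ for every $x\in S$ such that $$p(0)=-\Big(\frac{\partial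 g}{\partial q_1}(q^*(0),q^*(t_f^*))\Big)^{\!\top}\psi,\qquad p(t_f^*)=\Big(\frac{\partial g}{\partial q_2}(q^*(0),q^*(t_f^*))\Big)^{\!\top}\psi .$$ - *Transversality condition on the final time.* If the final time is left free, if $t_f^*>0$, and if $f$ and $f^0$ are of class $C^1$ with respect to $t$ in a neighborhood of $t_f^*$ (there is $\delta>0$ such that, for all $(q,u)$, the maps $t\mapsto f(t,q,u)$ and $t\mapsto f^0(t,q,u)$ are $C^1$ on $(t_f^*-\delta,t_f^*+\delta)$), then $$H\big(t_f^*,q^*(t_f^*),p(t_f^*),p^0,u^*(k_f^*T)\big)=0,$$ where $k_f^*=E(t_f^*/T)$ if $t_f^*\notin\mathbb N T$, and $k_f^*=E(t_f^*/T)-1$ if $t_f^*\in\mathbb N T$. -/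

import Mathlib

open Set MeasureTheory

noncomputable section

namespace SampledData

/-- `ℝᵈ` with its Euclidean norm and inner product. -/
abbrev E (d : ℕ) : Type := EuclideanSpace ℝ (Fin d)

/-- The final time of the problem is either prescribed or left free in `[0, +∞)`. -/
inductive FinalTime : Type
  | fixed (b : ℝ) : FinalTime
  | free : FinalTime

/-- The final times allowed by the specification. -/
def FinalTime.Allows : FinalTime → ℝ → Prop
  | .fixed b, t => 0 ≤ t ∧ t = b
  | .free, t => 0 ≤ t

/-- The data of an optimal sampled-data control problem: sampling period, dynamics, running cost,
terminal constraint map, control constraint set, terminal constraint set, final time. -/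
structure Problem (n m j : ℕ) : Type where
  T : ℝ
  f : ℝ → E n → E m → E n
  f₀ : ℝ → E n → E m → ℝ
  g : E n × E n → E j
  Ω : Set (E m)
  S : Set (E j)
  finalTime : FinalTime

/-- `F(t, q, u)` is continuous and of class `C¹` in `(q, u)`: the differential with respect to
`(q, u)` exists everywhere and is continuous in `(t, q, u)`. -/
def IsC1InStateControl {n m : ℕ} {V : Type*} [NormedAddCommGroup V] [NormedSpace ℝ V]
    (F : ℝ → E n → E m → V) : Prop :=
  Continuous (fun z : ℝ × E n × E m => F z.1 z.2.1 z.2.2) ∧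
  (∀ t : ℝ, Differentiable ℝ (fun x : E n × E m => F t x.1 x.2)) ∧
  Continuous (fun z : ℝ × E n × E m => fderiv ℝ (fun x : E n × E m => F z.1 x.1 x.2) z.2)

/-- The orthogonal of a convex set `S` at the point `x`. -/
def orthogonalAt {j : ℕ} (S : Set (E j)) (x : E j) : Set (E j) :=
  {x' | ∀ x'' ∈ S, inner ℝ x' (x'' - x) ≤ 0}

namespace Problem

variable {n m j : ℕ} (P : Problem n m j)

/-- The value at time `t` of the sampled-data control whose value at the controlling time `k T` is
`u k`: the sample-and-hold `u(k(t) T)` with `k(t) = E(t / T)`. -/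
def hold (u : ℕ → E m) (t : ℝ) : E m := u ⌊t / P.T⌋₊

/-- `q` is a trajectory on `[0, tf]` associated with the sampled-data control `u`. -/
def IsTrajectory (tf : ℝ) (u : ℕ → E m) (q : ℝ → E n) : Prop :=
  AbsolutelyContinuousOnInterval q 0 tf ∧
  ∀ᵐ t : ℝ, t ∈ Ico 0 tf → HasDerivAt q (P.f t (q t) (P.hold u t)) t

/-- All the constraints of the problem. -/
def IsAdmissible (tf : ℝ) (u : ℕ → E m) (q : ℝ → E n) : Prop :=
  P.finalTime.Allows tf ∧ (∀ k, u k ∈ P.Ω) ∧ P.IsTrajectory tf u q ∧ P.g (q 0, q tf) ∈ P.S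

/-- The cost to be minimized. -/
def cost (tf : ℝ) (u : ℕ → E m) (q : ℝ → E n) : ℝ :=
  ∫ t in (0 : ℝ)..tf, P.f₀ t (q t) (P.hold u t)

/-- `(tf, u, q)` is an optimal solution. -/
def IsOptimal (tf : ℝ) (u : ℕ → E m) (q : ℝ → E n) : Prop :=
  P.IsAdmissible tf u q ∧
  ∀ (tf' : ℝ) (u' : ℕ → E m) (q' : ℝ → E n),
    P.IsAdmissible tf' u' q' → P.cost tf u q ≤ P.cost tf' u' q'

/-- The Hamiltonian `H(t, q, p, p⁰, u)`. -/
def H (t : ℝ) (q p : E n) (p₀ : ℝ) (u : E m) : ℝ :=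
  inner ℝ p (P.f t q u) + p₀ * P.f₀ t q u

/-- `∂H/∂q`. -/
def gradStateH (t : ℝ) (q p : E n) (p₀ : ℝ) (u : E m) : E n :=
  gradient (fun x => P.H t x p p₀ u) q

/-- `∂H/∂p`. -/
def gradAdjointH (t : ℝ) (q p : E n) (p₀ : ℝ) (u : E m) : E n :=
  gradient (fun x => P.H t q x p₀ u) p

/-- `∂H/∂u`. -/
def gradControlH (t : ℝ) (q p : E n) (p₀ : ℝ) (u : E m) : E m :=
  gradient (fun x => P.H t q p p₀ x) u

/-- The extremal equations, almost everywhere on `[0, tf)`. -/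
def ExtremalEquations (tf : ℝ) (u : ℕ → E m) (q p : ℝ → E n) (p₀ : ℝ) : Prop :=
  ∀ᵐ t : ℝ, t ∈ Ico 0 tf →
    HasDerivAt q (P.gradAdjointH t (q t) (p t) p₀ (P.hold u t)) t ∧
    HasDerivAt p (-P.gradStateH t (q t) (p t) p₀ (P.hold u t)) t

/-- The averaged maximization condition at every controlling time `k T ∈ [0, tf)`; the upper end of
the sampling interval is `(k+1) T` if `(k+1) T ≤ tf`, and `tf` otherwise. -/
def MaximizationCondition (tf : ℝ) (u : ℕ → E m) (q p : ℝ → E n) (p₀ : ℝ) : Prop :=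
  ∀ k : ℕ, (k : ℝ) * P.T < tf → ∀ y ∈ P.Ω,
    inner ℝ (∫ τ in ((k : ℝ) * P.T)..(min (((k : ℝ) + 1) * P.T) tf),
      P.gradControlH τ (q τ) (p τ) p₀ (u k)) (y - u k) ≤ 0

/-- The differential of `g` at `(q₁, q₂)` is surjective. -/
def IsSubmersiveAt (q₁ q₂ : E n) : Prop :=
  Function.Surjective (fderiv ℝ P.g (q₁, q₂))

/-- The transversality conditions on the adjoint vector. -/
def AdjointTransversality (tf : ℝ) (q p : ℝ → E n) : Prop :=
  ∃ ψ : E j, -ψ ∈ orthogonalAt P.S (P.g (q 0, q tf)) ∧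
    p 0 = -(ContinuousLinearMap.adjoint (fderiv ℝ (fun x : E n => P.g (x, q tf)) (q 0)) ψ) ∧
    p tf = ContinuousLinearMap.adjoint (fderiv ℝ (fun x : E n => P.g (q 0, x)) (q tf)) ψ

/-- `f` and `f⁰` are of class `C¹` with respect to `t` in a neighborhood of `tf`. -/
def IsC1InTimeNear (tf : ℝ) : Prop :=
  ∃ δ > 0, ∀ (x : E n) (v : E m),
    ContDiffOn ℝ 1 (fun t => P.f t x v) (Ioo (tf - δ) (tf + δ)) ∧
    ContDiffOn ℝ 1 (fun t => P.f₀ t x v) (Ioo (tf - δ) (tf + δ))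

open Classical in
/-- The index of the last sampling interval that meets `[0, tf)` (for `tf > 0`):
`E(tf / T)` if `tf` is not a controlling time, and `E(tf / T) - 1` otherwise. -/
def lastIndex (tf : ℝ) : ℕ :=
  if ∃ k : ℕ, tf = (k : ℝ) * P.T then ⌊tf / P.T⌋₊ - 1 else ⌊tf / P.T⌋₊

end Problem

end SampledData

end

/-! A sampled-data control acts on `[0, tf)` only through finitely many values `u 0, …, u K`, where
`K T < tf ≤ (K + 1) T`. Near the optimum, the problem is therefore finite-dimensional: the unknowns
are the initial state, the values `u 0, …, u K` and the final time. No needle variations are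
available, nor needed. First-order variations of the values within the convex set `Ω` give a
maximization condition averaged over each sampling interval, rather than pointwise.

Three facts carry the argument. The field `(f, f⁰)` can be altered far from the optimal trajectory
so as to be bounded, Lipschitz and uniformly `C¹` (`exists_isUniformlyC1_eqOn_ball`), so that all
its solutions are global. The final value of its flow is strictly differentiable in all unknowns,
with a derivative expressed by the backward resolvent `Λ` of the linearized equation
(`IsFlow.hasStrictFDerivAt`). Holding the last control value beyond `(K + 1) T` makes the velocity
continuous at `tf`, which gives differentiability in the final time even when `tf` is a controlling
time. Finally, a Fritz John rule (`exists_fritzJohn_multipliers`), proved by penalization, yields `c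
≤ 0` and `ψ`, not both zero, such that `c J' + ⟨ψ, G'⟩ ≤ 0` in all admissible directions.

The final covector built from `(c, ψ)`, transported backwards by `Λ`, has a state part `p` and a
constant cost part `p⁰ = c`. Varying the initial state gives the value of `p 0`, varying one control
value gives the maximization condition, and varying the final time gives the vanishing of `H`.
Surjectivity of the differential of `g` prevents `(p, p⁰)` from vanishing. Without it, no
transversality on `p` is claimed, and the terminal constraint may be replaced by fixed end points,
whose constraint map is submersive. -/

namespace SampledData

open Filter Topology

/-! ### Integral equations with data continuous off a countable set of times. -/

section Integral

variable {W : Type*} [NormedAddCommGroup W]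

lemma aestronglyMeasurable_of_continuousAt_off_countable {C : Set ℝ} (hC : C.Countable)
    {f : ℝ → W} (hf : ∀ t ∉ C, ContinuousAt f t) : AEStronglyMeasurable f volume := by
  have h1 : ContinuousOn f Cᶜ := fun t ht => (hf t ht).continuousWithinAt
  have h2 := h1.aestronglyMeasurable (μ := volume) hC.measurableSet.compl
  rwa [Measure.restrict_eq_self_of_ae_mem] at h2
  exact hC.ae_notMem volume

lemma intervalIntegrable_of_continuousAt_off_countable {C : Set ℝ} (hC : C.Countable)
    {f : ℝ → W} (hf : ∀ t ∉ C, ContinuousAt f t) {a b M : ℝ} (hM : ∀ t ∈ uIcc a b, ‖f t‖ ≤ M) :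
    IntervalIntegrable f volume a b := by
  refine (intervalIntegrable_const (c := M)).mono_fun
    (aestronglyMeasurable_of_continuousAt_off_countable hC hf).restrict ?_
  refine (ae_restrict_iff' measurableSet_uIoc).2 (ae_of_all _ fun t ht => ?_)
  exact (hM t (uIoc_subset_uIcc ht)).trans (le_abs_self M)

variable [NormedSpace ℝ W]

lemma hasDerivAt_integral_of_continuousAt_off_countable [CompleteSpace W] {C : Set ℝ}
    (hC : C.Countable) {f : ℝ → W} (hf : ∀ t ∉ C, ContinuousAt f t) {a t : ℝ}
    (hi : IntervalIntegrable f volume a t) (ht : t ∉ C) :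
    HasDerivAt (fun s => ∫ x in a..s, f x) (f t) t :=
  intervalIntegral.integral_hasDerivAt_right hi
    ((aestronglyMeasurable_of_continuousAt_off_countable hC hf).stronglyMeasurableAtFilter) (hf t ht)

/-- Grönwall's inequality in integral form. -/
lemma le_mul_exp_of_le_add_integral {u : ℝ → ℝ} {a L b : ℝ} (hL : 0 ≤ L)
    (hu : ContinuousOn u (Icc 0 b)) (h : ∀ t ∈ Icc 0 b, u t ≤ a + L * ∫ s in (0 : ℝ)..t, u s) :
    ∀ t ∈ Icc 0 b, u t ≤ a * Real.exp (L * t) := by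
  intro t ht
  have hb : (0 : ℝ) ≤ b := ht.1.trans ht.2
  -- Extending `u` by its end values makes its primitive differentiable at every point.
  set v : ℝ → ℝ := fun s => u (projIcc 0 b hb s) with hv
  have hvc : Continuous v := by
    have := (continuousOn_iff_continuous_domRestrict.1 hu).comp (continuous_projIcc (h := hb))
    exact this
  have hvu : ∀ s ∈ Icc 0 b, v s = u s := fun s hs => by simp [hv, projIcc_of_mem hb hs]
  have hint : ∀ t ∈ Icc 0 b, ∫ s in (0 : ℝ)..t, u s = ∫ s in (0 : ℝ)..t, v s := by
    intro t ht
    refine intervalIntegral.integral_congr fun s hs => ?_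
    rw [uIcc_of_le ht.1] at hs
    exact (hvu s ⟨hs.1, hs.2.trans ht.2⟩).symm
  have hd : ∀ x, HasDerivAt (fun t => a + L * ∫ s in (0 : ℝ)..t, v s) (L * v x) x := fun x =>
    ((hvc.integral_hasStrictDerivAt 0 x).hasDerivAt.const_mul L).const_add a
  -- The differential Grönwall inequality is applied to the upper bound `a + L ∫ v`, which is
  -- differentiable, and not to `u`.
  have key := le_gronwallBound_of_liminf_deriv_right_le (a := 0) (b := b) (K := L) (ε := 0)
    (δ := a) (f' := fun x => L * v x)
    (continuous_iff_continuousAt.2 fun x => (hd x).continuousAt).continuousOn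
    (fun x _ r hr => ((hd x).hasDerivWithinAt (s := Ici x)).liminf_right_slope_le hr)
    (by simp) (fun x hx => by
      have hx' := Ico_subset_Icc_self hx
      have := h x hx'
      rw [hint x hx', ← hvu x hx'] at this
      rw [add_zero]
      exact mul_le_mul_of_nonneg_left this hL) t ht
  rw [gronwallBound_ε0, sub_zero, ← hint t ht] at key
  exact (h t ht).trans key

/-- Global existence for the integral form of an ordinary differential equation whose right-hand
side is Lipschitz in the state and merely integrable in time. -/
theorem exists_eq_add_integral [CompleteSpace W] {v : ℝ → W → W} {K : ℝ}
    (hK : 0 ≤ K) (hlip : ∀ t x y, ‖v t x - v t y‖ ≤ K * ‖x - y‖)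
    (hint : ∀ x : ℝ → W, Continuous x → ∀ a b, IntervalIntegrable (fun s => v s (x s)) volume a b)
    {b : ℝ} (hb : 0 ≤ b) (x₀ : W) :
    ∃ x : ℝ → W, Continuous x ∧ ∀ t ∈ Icc 0 b, x t = x₀ + ∫ s in (0 : ℝ)..t, v s (x s) := by
  -- With the weight `exp (-c t)` the Picard operator is Lipschitz with constant `K / c ≤ 1 / 2`, so
  -- one contraction covers the whole interval. A point `y` of the function space encodes the curve
  -- `exp (c s) • y s`.
  set c : ℝ := 2 * (K + 1) with hc
  have hc0 : 0 < c := by positivity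
  let w : C(Icc (0 : ℝ) b, W) → ℝ → W := fun y s => Real.exp (c * s) • y (projIcc 0 b hb s)
  have hw : ∀ y, Continuous (w y) := fun y => by
    have := y.continuous.comp (continuous_projIcc (h := hb))
    exact Continuous.smul (by fun_prop) this
  let I : C(Icc (0 : ℝ) b, W) → ℝ → W := fun y t => x₀ + ∫ s in (0 : ℝ)..t, v s (w y s)
  have hI : ∀ y, Continuous (I y) := fun y =>
    continuous_const.add (intervalIntegral.continuous_primitive (hint _ (hw y)) 0)
  let Ψ : C(Icc (0 : ℝ) b, W) → C(Icc (0 : ℝ) b, W) := fun y =>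
    ⟨fun t => Real.exp (-(c * t)) • I y t,
      Continuous.smul (by fun_prop) ((hI y).comp continuous_subtype_val)⟩
  have hΨ : ContractingWith (1 / 2) Ψ := by
    refine ⟨by rw [← NNReal.coe_lt_coe]; norm_num, LipschitzWith.of_dist_le_mul fun y y' => ?_⟩
    rw [ContinuousMap.dist_le (by positivity)]
    rintro ⟨t, ht⟩
    have h1 : I y t - I y' t = ∫ s in (0 : ℝ)..t, (v s (w y s) - v s (w y' s)) := by
      rw [intervalIntegral.integral_sub (hint _ (hw y) _ _) (hint _ (hw y') _ _)]
      simp only [I]; abel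
    have h2 : ‖I y t - I y' t‖ ≤ ∫ s in (0 : ℝ)..t, K * (Real.exp (c * s) * dist y y') := by
      rw [h1]
      refine intervalIntegral.norm_integral_le_of_norm_le ht.1 (ae_of_all _ fun s _ => ?_)
        (by apply Continuous.intervalIntegrable; fun_prop)
      refine (hlip _ _ _).trans (mul_le_mul_of_nonneg_left ?_ hK)
      simp only [w]
      rw [← smul_sub, norm_smul, Real.norm_of_nonneg (Real.exp_pos _).le, ← dist_eq_norm]
      exact mul_le_mul_of_nonneg_left (ContinuousMap.dist_apply_le_dist _) (Real.exp_pos _).le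
    have h3 : ∫ s in (0 : ℝ)..t, K * (Real.exp (c * s) * dist y y')
        = K * dist y y' * ((Real.exp (c * t) - 1) / c) := by
      have : ∀ s, HasDerivAt (fun s => K * dist y y' * (Real.exp (c * s) / c))
          (K * (Real.exp (c * s) * dist y y')) s := fun s => by
        have h := (((hasDerivAt_id s).const_mul c).exp.div_const c).const_mul (K * dist y y')
        refine h.congr_deriv ?_
        simp only [id]
        field_simp
      rw [intervalIntegral.integral_eq_sub_of_hasDerivAt (fun s _ => this s)
        (by apply Continuous.intervalIntegrable; fun_prop)]
      simp; ring
    rw [dist_eq_norm]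
    change ‖Real.exp (-(c * t)) • I y t - Real.exp (-(c * t)) • I y' t‖ ≤ _
    rw [← smul_sub, norm_smul, Real.norm_of_nonneg (Real.exp_pos _).le]
    have h4 : Real.exp (-(c * t)) * Real.exp (c * t) = 1 := by rw [← Real.exp_add]; simp
    calc Real.exp (-(c * t)) * ‖I y t - I y' t‖
        ≤ Real.exp (-(c * t)) * (K * dist y y' * ((Real.exp (c * t) - 1) / c)) := by
          rw [← h3]; gcongr
      _ = (K / c) * dist y y' * (1 - Real.exp (-(c * t))) := by
          have : K / c * dist y y' * (Real.exp (-(c * t)) * Real.exp (c * t) - Real.exp (-(c * t)))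
            = Real.exp (-(c * t)) * (K * dist y y' * ((Real.exp (c * t) - 1) / c)) := by ring
          rw [← this, h4]
      _ ≤ (K / c) * dist y y' * 1 := by
          gcongr
          linarith [Real.exp_pos (-(c * t))]
      _ ≤ ((1 / 2 : NNReal) : ℝ) * dist y y' := by
          rw [mul_one]
          gcongr
          rw [div_le_iff₀ hc0, hc]; push_cast; linarith
  set y := ContractingWith.fixedPoint Ψ hΨ
  have hy : Ψ y = y := hΨ.fixedPoint_isFixedPt
  refine ⟨w y, hw y, fun t ht => ?_⟩
  have h1 : (Ψ y) ⟨t, ht⟩ = y ⟨t, ht⟩ := by rw [hy]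
  change Real.exp (-(c * t)) • I y t = _ at h1
  change Real.exp (c * t) • y (projIcc 0 b hb t) = I y t
  rw [projIcc_of_mem hb ht, ← h1, smul_smul, ← Real.exp_add]
  simp

/-- An absolutely continuous function is the integral of its almost everywhere derivative, when the
latter is continuous off a countable set. -/
lemma _root_.AbsolutelyContinuousOnInterval.eq_add_integral [CompleteSpace W] {C : Set ℝ}
    (hC : C.Countable) {f f' : ℝ → W} {b M : ℝ} (hf : AbsolutelyContinuousOnInterval f 0 b)
    (hb : 0 ≤ b) (hM : ∀ t, ‖f' t‖ ≤ M)
    (hf' : ∀ t ∉ C, ContinuousAt f' t)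
    (hd : ∀ᵐ t : ℝ, t ∈ Ico 0 b → HasDerivAt f (f' t) t) :
    ∀ t ∈ Icc 0 b, f t = f 0 + ∫ s in (0 : ℝ)..t, f' s := by
  have hi : ∀ a b, IntervalIntegrable f' volume a b := fun a b =>
    intervalIntegrable_of_continuousAt_off_countable hC hf' (fun t _ => hM t)
  have hlip : LipschitzWith ⟨|M|, abs_nonneg M⟩ (fun t => ∫ s in (0 : ℝ)..t, f' s) := by
    refine LipschitzWith.of_dist_le_mul fun x y => ?_
    rw [dist_eq_norm, intervalIntegral.integral_interval_sub_left (hi _ _) (hi _ _),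
      Real.dist_eq]
    exact intervalIntegral.norm_integral_le_of_norm_le_const
      fun t _ => (hM t).trans (le_abs_self M)
  -- The difference with the primitive is absolutely continuous with zero derivative almost
  -- everywhere, hence constant.
  obtain ⟨c, hc⟩ := (hf.sub hlip.lipschitzOnWith.absolutelyContinuousOnInterval)
    |>.const_of_ae_hasDerivAt_zero (by
      filter_upwards [hd, hC.ae_notMem volume, (Set.countable_singleton b).ae_notMem volume]
        with t h1 h2 h3 ht
      rw [uIcc_of_le hb] at ht
      have := (h1 ⟨ht.1, lt_of_le_of_ne ht.2 h3⟩).sub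
        (hasDerivAt_integral_of_continuousAt_off_countable hC hf' (hi 0 t) h2)
      rwa [sub_self] at this)
  rw [uIcc_of_le hb] at hc
  intro t ht
  have h0 := hc 0 ⟨le_rfl, hb⟩
  have h1 := hc t ht
  simp at h0 h1
  rw [h0, ← h1]; abel

end Integral

end SampledData

namespace SampledData

open Filter Topology

/-! ### A Fritz John multiplier rule by penalization. -/

section Multipliers

/-- Dividing by `ε` and letting `ε → 0⁺` extracts a first-order condition from minimality along a
segment. -/
lemma nonneg_of_eventually_nonneg_mul_add_sq {A B : ℝ}
    (h : ∀ᶠ ε in 𝓝[>] (0 : ℝ), 0 ≤ ε * A + ε ^ 2 * B) : 0 ≤ A := by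
  have h1 : Tendsto (fun ε : ℝ => A + ε * B) (𝓝[>] 0) (𝓝 A) := by
    have : Tendsto (fun ε : ℝ => A + ε * B) (𝓝 0) (𝓝 (A + 0 * B)) := by
      apply Continuous.tendsto; fun_prop
    simpa using this.mono_left nhdsWithin_le_nhds
  refine ge_of_tendsto h1 ?_
  filter_upwards [h, self_mem_nhdsWithin] with ε hε (hpos : 0 < ε)
  have : 0 ≤ ε * (A + ε * B) := by nlinarith
  exact nonneg_of_mul_nonneg_right this hpos

variable {X Y : Type*} [NormedAddCommGroup X] [NormedSpace ℝ X]
  [NormedAddCommGroup Y] [InnerProductSpace ℝ Y]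

lemma eventually_add_smul_mem {s : Set X} {x : X} (hs : s ∈ 𝓝 x) (v : X) :
    ∀ᶠ ε in 𝓝[>] (0 : ℝ), x + ε • v ∈ s := by
  have : Tendsto (fun ε : ℝ => x + ε • v) (𝓝 0) (𝓝 (x + (0 : ℝ) • v)) := by
    apply Continuous.tendsto; fun_prop
  rw [zero_smul, add_zero] at this
  exact (this.mono_left nhdsWithin_le_nhds) hs

lemma _root_.Convex.eventually_add_smul_sub_mem {s : Set X} (hs : Convex ℝ s) {x y : X}
    (hx : x ∈ s) (hy : y ∈ s) : ∀ᶠ ε in 𝓝[>] (0 : ℝ), x + ε • (y - x) ∈ s := by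
  filter_upwards [Ioc_mem_nhdsGT (zero_lt_one (α := ℝ))] with ε hε
  exact hs.add_smul_sub_mem hx hy ⟨hε.1.le, hε.2⟩

/-- First order condition in the state variable for the penalized problem. -/
lemma penalty_first_order_left {U : Set X} {J : X → ℝ} {G : X → Y} {J' : X →L[ℝ] ℝ}
    {G' : X →L[ℝ] Y} {η k : ℝ} (hk : 0 ≤ k) {x₀ x v : X} {s : Y} (hU : U ∈ 𝓝 x)
    (hJ : ∀ y ∈ U, ‖J y - J x - J' (y - x)‖ ≤ η * ‖y - x‖)
    (hG : ∀ y ∈ U, ‖G y - G x - G' (y - x)‖ ≤ η * ‖y - x‖)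
    (hmin : ∀ᶠ ε in 𝓝[>] (0 : ℝ), J x + ‖x - x₀‖ ^ 2 + k * ‖G x - s‖ ^ 2 ≤
      J (x + ε • v) + ‖x + ε • v - x₀‖ ^ 2 + k * ‖G (x + ε • v) - s‖ ^ 2) :
    0 ≤ J' v + inner ℝ ((2 * k) • (G x - s)) (G' v) +
      (η + 2 * ‖x - x₀‖ + ‖(2 * k) • (G x - s)‖ * η) * ‖v‖ := by
  -- The coefficient `B` collects the quadratic terms: `‖ε • v‖ ^ 2` and the penalty of the
  -- increment of `G`, whose norm is at most `ε (‖G'‖ + η) ‖v‖`. The maps `J'` and `G'` approximate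
  -- increments from `x` only up to `η`, whence the error terms in the conclusion.
  apply nonneg_of_eventually_nonneg_mul_add_sq
    (B := ‖v‖ ^ 2 + k * ((‖G'‖ + η) * ‖v‖) ^ 2)
  filter_upwards [hmin, eventually_add_smul_mem hU v, self_mem_nhdsWithin] with ε h1 h2 (hε : 0 < ε)
  have e1 : x + ε • v - x = ε • v := by abel
  have hJ1 := hJ _ h2
  have hG1 := hG _ h2
  rw [e1, norm_smul, Real.norm_of_nonneg hε.le, map_smul] at hJ1 hG1
  set y := x + ε • v
  rw [Real.norm_eq_abs, abs_le, smul_eq_mul] at hJ1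
  set Δ := G y - G x
  have hΔ : ‖Δ‖ ≤ ε * ((‖G'‖ + η) * ‖v‖) := by
    calc ‖Δ‖ = ‖(Δ - ε • G' v) + ε • G' v‖ := by simp
      _ ≤ η * (ε * ‖v‖) + ε * (‖G'‖ * ‖v‖) := by
        refine (norm_add_le _ _).trans (add_le_add hG1 ?_)
        rw [norm_smul, Real.norm_of_nonneg hε.le]
        exact mul_le_mul_of_nonneg_left (G'.le_opNorm v) hε.le
      _ = _ := by ring
  have hsq : ‖G y - s‖ ^ 2 = ‖G x - s‖ ^ 2 + 2 * inner ℝ (G x - s) Δ + ‖Δ‖ ^ 2 := by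
    rw [← norm_add_sq_real]; congr 2; simp only [Δ]; abel
  have hin : inner ℝ (G x - s) Δ ≤ ε * inner ℝ (G x - s) (G' v) + ‖G x - s‖ * (η * (ε * ‖v‖)) := by
    have : inner ℝ (G x - s) Δ = inner ℝ (G x - s) (Δ - ε • G' v) +
        ε * inner ℝ (G x - s) (G' v) := by
      rw [← real_inner_smul_right, ← inner_add_right]; simp
    rw [this, add_comm]
    gcongr
    exact (real_inner_le_norm _ _).trans (by gcongr)
  have hnx : ‖y - x₀‖ ≤ ‖x - x₀‖ + ε * ‖v‖ := by
    have : y - x₀ = (x - x₀) + ε • v := by simp only [y]; abel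
    rw [this]
    refine (norm_add_le _ _).trans ?_
    rw [norm_smul, Real.norm_of_nonneg hε.le]
  have hnx2 : ‖y - x₀‖ ^ 2 ≤ (‖x - x₀‖ + ε * ‖v‖) ^ 2 := by gcongr
  have hΔ2 : ‖Δ‖ ^ 2 ≤ (ε * ((‖G'‖ + η) * ‖v‖)) ^ 2 := by gcongr
  rw [real_inner_smul_left, norm_smul, Real.norm_of_nonneg (by positivity : 0 ≤ 2 * k)]
  rw [hsq] at h1
  have h5 := mul_le_mul_of_nonneg_left hin (by positivity : 0 ≤ 2 * k)
  have h6 := mul_le_mul_of_nonneg_left hΔ2 hk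
  linarith [hJ1.2]

/-- First order condition in the slack variable for the penalized problem. -/
lemma penalty_first_order_right {k : ℝ} {g s₀ s w : Y}
    (hmin : ∀ᶠ ε in 𝓝[>] (0 : ℝ), ‖s - s₀‖ ^ 2 + k * ‖g - s‖ ^ 2 ≤
      ‖s + ε • w - s₀‖ ^ 2 + k * ‖g - (s + ε • w)‖ ^ 2) :
    inner ℝ ((2 * k) • (g - s)) w ≤ 2 * ‖s - s₀‖ * ‖w‖ := by
  suffices 0 ≤ 2 * inner ℝ (s - s₀) w - inner ℝ ((2 * k) • (g - s)) w by
    linarith [real_inner_le_norm (s - s₀) w]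
  apply nonneg_of_eventually_nonneg_mul_add_sq (B := ‖w‖ ^ 2 + k * ‖w‖ ^ 2)
  filter_upwards [hmin] with ε h1
  have e1 : s + ε • w - s₀ = (s - s₀) + ε • w := by abel
  have e2 : g - (s + ε • w) = (g - s) - ε • w := by abel
  rw [e1, e2, norm_add_sq_real (s - s₀), norm_sub_sq_real (g - s) (ε • w), real_inner_smul_right, real_inner_smul_right,
    norm_smul, mul_pow, Real.norm_eq_abs, sq_abs] at h1
  rw [real_inner_smul_left]
  linarith

/-- Fritz John multiplier rule for the minimization of `J` on a closed convex set `C` under the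
constraint `G ∈ S`, with `S` closed and convex, in finite dimension. -/
theorem exists_fritzJohn_multipliers [FiniteDimensional ℝ X] [FiniteDimensional ℝ Y]
    {C : Set X} {S : Set Y} (hCc : IsClosed C) (hC : Convex ℝ C) (hSc : IsClosed S)
    (hS : Convex ℝ S) {J : X → ℝ} {G : X → Y} {x₀ : X} {J' : X →L[ℝ] ℝ} {G' : X →L[ℝ] Y}
    (hJ : HasStrictFDerivAt J J' x₀) (hG : HasStrictFDerivAt G G' x₀) (hx₀ : x₀ ∈ C)
    (hGx₀ : G x₀ ∈ S) (hmin : ∀ᶠ x in 𝓝 x₀, x ∈ C → G x ∈ S → J x₀ ≤ J x) :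
    ∃ (c : ℝ) (ψ : Y), c ≤ 0 ∧ (c ≠ 0 ∨ ψ ≠ 0) ∧ (∀ s ∈ S, inner ℝ (-ψ) (s - G x₀) ≤ 0) ∧
      ∀ x ∈ C, c * J' (x - x₀) + inner ℝ ψ (G' (x - x₀)) ≤ 0 := by
  have : ProperSpace X := FiniteDimensional.proper_real X
  have : ProperSpace Y := FiniteDimensional.proper_real Y
  obtain ⟨_, sJ, hsJ, hJl⟩ := hJ.exists_lipschitzOnWith
  obtain ⟨_, sG, hsG, hGl⟩ := hG.exists_lipschitzOnWith
  obtain ⟨r, hr, hball⟩ := Metric.nhds_basis_closedBall.mem_iff.1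
    (inter_mem (inter_mem hsJ hsG) hmin)
  set D : Set (X × Y) := (C ∩ Metric.closedBall x₀ r) ×ˢ (S ∩ Metric.closedBall (G x₀) 1) with hD
  have hDc : IsCompact D := ((isCompact_closedBall _ _).inter_left hCc).prod
    ((isCompact_closedBall _ _).inter_left hSc)
  have hJc : ContinuousOn (fun z : X × Y => J z.1) D :=
    (hJl.continuousOn.mono fun x hx => (hball hx).1.1).comp continuousOn_fst fun z hz => hz.1.2
  have hGc : ContinuousOn (fun z : X × Y => G z.1) D :=
    (hGl.continuousOn.mono fun x hx => (hball hx).1.2).comp continuousOn_fst fun z hz => hz.1.2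
  have h0D : (x₀, G x₀) ∈ D := ⟨⟨hx₀, Metric.mem_closedBall_self hr.le⟩, hGx₀,
    Metric.mem_closedBall_self zero_le_one⟩
  -- The constraint `G x = s`, with slack `s ∈ S`, is penalized with weight `k`. The two other
  -- squares force the minimizers to converge to `(x₀, G x₀)`, although `x₀` need not be a strict
  -- minimum.
  let φ : ℕ → X × Y → ℝ := fun k z =>
    J z.1 + ‖z.1 - x₀‖ ^ 2 + ‖z.2 - G x₀‖ ^ 2 + k * ‖G z.1 - z.2‖ ^ 2
  have hφ : ∀ k, ∃ z ∈ D, IsMinOn (φ k) D z := fun k =>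
    hDc.exists_isMinOn ⟨_, h0D⟩ (by
      have : ContinuousOn (fun z : X × Y => ‖z.1 - x₀‖ ^ 2 + ‖z.2 - G x₀‖ ^ 2) D := by fun_prop
      refine ((hJc.add (by fun_prop)).add (by fun_prop)).add ?_
      exact continuousOn_const.mul ((hGc.sub continuousOn_snd).norm.pow 2))
  choose z hzD hzmin using hφ
  have hz0 : ∀ k, φ k (z k) ≤ J x₀ := fun k => by
    have := hzmin k h0D
    simpa [φ] using this
  let nv : ℕ → Y := fun k => (2 * (k : ℝ)) • (G (z k).1 - (z k).2)
  -- The pair `(1, nv k)` is the multiplier of the penalized problem. It may be unbounded, so it is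
  -- normalized to `a + ‖a • nv‖ = 1`; this relation survives in the limit and keeps the limit
  -- multiplier nonzero.
  let a : ℕ → ℝ := fun k => (1 + ‖nv k‖)⁻¹
  have hapos : ∀ k, 0 < a k := fun k => by positivity
  have ha1 : ∀ k, a k + ‖a k • nv k‖ = 1 := fun k => by
    rw [norm_smul, Real.norm_of_nonneg (hapos k).le]
    have : (1 + ‖nv k‖) ≠ 0 := by positivity
    simp only [a]; field_simp
  have hcomp : IsCompact (D ×ˢ (Icc (0 : ℝ) 1 ×ˢ Metric.closedBall (0 : Y) 1)) :=
    hDc.prod (isCompact_Icc.prod (isCompact_closedBall _ _))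
  obtain ⟨⟨⟨xb, sb⟩, α, ν⟩, ⟨hbD, hα, hν⟩, σ, hσ, hlim⟩ :=
    hcomp.tendsto_subseq (x := fun k => (z k, a k, a k • nv k)) fun k => by
      have h1 := ha1 k
      refine ⟨hzD k, ⟨(hapos k).le, ?_⟩, ?_⟩
      · linarith [norm_nonneg (a k • nv k)]
      · rw [mem_closedBall_zero_iff]; linarith [hapos k]
  have hlimz : Tendsto (fun i => z (σ i)) atTop (𝓝 (xb, sb)) := hlim.fst_nhds
  have hlima : Tendsto (fun i => a (σ i)) atTop (𝓝 α) := hlim.snd_nhds.fst_nhds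
  have hlimn : Tendsto (fun i => a (σ i) • nv (σ i)) atTop (𝓝 ν) := hlim.snd_nhds.snd_nhds
  have hlimD : Tendsto (fun i => z (σ i)) atTop (𝓝[D] (xb, sb)) :=
    tendsto_nhdsWithin_iff.2 ⟨hlimz, Eventually.of_forall fun i => hzD _⟩
  have hlimJ : Tendsto (fun i => J (z (σ i)).1) atTop (𝓝 (J xb)) := (hJc _ hbD).tendsto.comp hlimD
  have hlimG : Tendsto (fun i => G (z (σ i)).1) atTop (𝓝 (G xb)) := (hGc _ hbD).tendsto.comp hlimD
  have hlimx : Tendsto (fun i => (z (σ i)).1) atTop (𝓝 xb) := hlimz.fst_nhds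
  have hlims : Tendsto (fun i => (z (σ i)).2) atTop (𝓝 sb) := hlimz.snd_nhds
  -- The bound `φ k (z k) ≤ J x₀`, divided by `k`, shows that the penalized quantity tends to zero.
  have hGs : G xb = sb := by
    have h1 : Tendsto (fun i => ‖G (z (σ i)).1 - (z (σ i)).2‖ ^ 2) atTop (𝓝 (‖G xb - sb‖ ^ 2)) :=
      (hlimG.sub hlims).norm.pow 2
    have h2 : Tendsto (fun i => (J x₀ - J (z (σ i)).1) * ((σ i : ℕ) : ℝ)⁻¹) atTop
        (𝓝 ((J x₀ - J xb) * 0)) :=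
      (hlimJ.const_sub _).mul (tendsto_inv_atTop_nhds_zero_nat.comp hσ.tendsto_atTop)
    have h3 := le_of_tendsto_of_tendsto h1 h2 (by
      filter_upwards [eventually_gt_atTop 0] with i hi
      have hk : (0 : ℝ) < σ i := by exact_mod_cast lt_of_lt_of_le hi (hσ.id_le i)
      have := hz0 (σ i)
      simp only [φ] at this
      rw [← div_eq_mul_inv, le_div_iff₀ hk]
      nlinarith [sq_nonneg ‖(z (σ i)).1 - x₀‖, sq_nonneg ‖(z (σ i)).2 - G x₀‖])
    rw [mul_zero] at h3
    have h4 : ‖G xb - sb‖ = 0 := by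
      have := sq_nonneg ‖G xb - sb‖
      exact pow_eq_zero_iff (two_ne_zero) |>.1 (le_antisymm h3 this)
    exact sub_eq_zero.1 (norm_eq_zero.1 h4)
  have hJb : J x₀ ≤ J xb := (hball hbD.1.2).2 hbD.1.1 (hGs ▸ hbD.2.1)
  -- The limit point is feasible, so `J x₀ ≤ J xb`; dropping the penalty and passing to the limit
  -- then leaves no room for the squares.
  have hsum : J xb + ‖xb - x₀‖ ^ 2 + ‖sb - G x₀‖ ^ 2 ≤ J x₀ := by
    refine le_of_tendsto ((hlimJ.add ((hlimx.sub_const x₀).norm.pow 2)).add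
      ((hlims.sub_const (G x₀)).norm.pow 2)) (Eventually.of_forall fun i => ?_)
    have := hz0 (σ i)
    simp only [φ] at this
    have h5 : 0 ≤ ((σ i : ℕ) : ℝ) * ‖G (z (σ i)).1 - (z (σ i)).2‖ ^ 2 := by positivity
    linarith
  have hxb : xb = x₀ := by
    have : ‖xb - x₀‖ ^ 2 = 0 :=
      le_antisymm (by linarith [sq_nonneg ‖sb - G x₀‖]) (sq_nonneg _)
    exact sub_eq_zero.1 (norm_eq_zero.1 (pow_eq_zero_iff two_ne_zero |>.1 this))
  subst hxb
  subst hGs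
  refine ⟨-α, -ν, neg_nonpos.2 hα.1, ?_, fun s hs => ?_, fun x hx => ?_⟩
  · by_contra! hcon
    have h1 : α + ‖ν‖ = 1 := tendsto_nhds_unique (hlima.add hlimn.norm) (by simp [ha1])
    rw [neg_eq_zero.1 hcon.1, neg_eq_zero.1 hcon.2] at h1
    simp at h1
  · rw [neg_neg]
    have h1 : Tendsto (fun i => inner ℝ (a (σ i) • nv (σ i)) (s - (z (σ i)).2)) atTop
        (𝓝 (inner ℝ ν (s - G xb))) := hlimn.inner (hlims.const_sub s)
    have h2 : Tendsto (fun i => a (σ i) * (2 * ‖(z (σ i)).2 - G xb‖ * ‖s - (z (σ i)).2‖)) atTop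
        (𝓝 (α * (2 * ‖G xb - G xb‖ * ‖s - G xb‖))) :=
      hlima.mul (((hlims.sub_const _).norm.const_mul 2).mul (hlims.const_sub s).norm)
    have h3 := le_of_tendsto_of_tendsto h1 h2 (by
      -- Eventually the slack lies in the open unit ball, so the artificial ball constraint is
      -- inactive and every direction towards a point of `S` is allowed.
      filter_upwards [hlims (Metric.ball_mem_nhds _ zero_lt_one)] with i hi
      rw [real_inner_smul_left]
      refine mul_le_mul_of_nonneg_left (penalty_first_order_right ?_) (hapos _).le
      filter_upwards [hS.eventually_add_smul_sub_mem (hzD (σ i)).2.1 hs,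
        eventually_add_smul_mem (Metric.isOpen_ball.mem_nhds hi) (s - (z (σ i)).2)] with ε h4 h5
      have := hzmin (σ i) (show ((z (σ i)).1, (z (σ i)).2 + ε • (s - (z (σ i)).2)) ∈ D from
        ⟨(hzD (σ i)).1, h4, Metric.ball_subset_closedBall h5⟩)
      simp only [φ, mem_ofPred_eq] at this
      linarith)
    simpa using h3
  · refine le_of_forall_pos_le_add fun η hη => ?_
    -- With tolerance `η / N` in the differentials, the limit error `2 (η / N) ‖x - xb‖` is at most
    -- `η`.
    set N := 2 * ‖x - xb‖ + 1
    have hN : 0 < N := by positivity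
    have h1 : Tendsto (fun i => a (σ i) * J' (x - (z (σ i)).1) +
        inner ℝ (a (σ i) • nv (σ i)) (G' (x - (z (σ i)).1))) atTop
        (𝓝 (α * J' (x - xb) + inner ℝ ν (G' (x - xb)))) :=
      (hlima.mul ((J'.continuous.tendsto _).comp (hlimx.const_sub x))).add
        (hlimn.inner ((G'.continuous.tendsto _).comp (hlimx.const_sub x)))
    have h2 : Tendsto (fun i => -((2 * (η / N) + 2 * ‖(z (σ i)).1 - xb‖) * ‖x - (z (σ i)).1‖))
        atTop (𝓝 (-((2 * (η / N) + 2 * ‖xb - xb‖) * ‖x - xb‖))) :=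
      ((((hlimx.sub_const _).norm.const_mul 2).const_add _).mul (hlimx.const_sub x).norm).neg
    have hη' : 0 < η / N := by positivity
    -- Strict differentiability compares any two points close to `xb`, so the differential at `xb`
    -- can be used at the minimizers, where nothing is known about differentiability.
    have hJe := hJ.isLittleO.def hη'
    have hGe := hG.isLittleO.def hη'
    rw [nhds_prod_eq] at hJe hGe
    obtain ⟨UJ, hUJ, hUJ'⟩ := mem_prod_self_iff.1 hJe
    obtain ⟨UG, hUG, hUG'⟩ := mem_prod_self_iff.1 hGe
    have h3 := le_of_tendsto_of_tendsto h2 h1 (by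
      filter_upwards [hlimx (interior_mem_nhds.2 (inter_mem hUJ hUG)),
        hlimx (Metric.ball_mem_nhds _ hr)] with i hi hi2
      have hU : UJ ∩ UG ∈ 𝓝 (z (σ i)).1 := mem_interior_iff_mem_nhds.1 hi
      have h4 := penalty_first_order_left (k := (σ i : ℕ)) (s := (z (σ i)).2) (x₀ := xb) (J' := J')
        (G' := G') (J := J) (G := G) (v := x - (z (σ i)).1) (Nat.cast_nonneg _) hU
        (fun y hy => hUJ' (Set.mk_mem_prod hy.1 (mem_of_mem_nhds hU).1))
        (fun y hy => hUG' (Set.mk_mem_prod hy.2 (mem_of_mem_nhds hU).2)) (by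
          filter_upwards [hC.eventually_add_smul_sub_mem (hzD (σ i)).1.1 hx,
            eventually_add_smul_mem (Metric.isOpen_ball.mem_nhds hi2) (x - (z (σ i)).1)]
            with ε h4 h5
          have := hzmin (σ i) (show ((z (σ i)).1 + ε • (x - (z (σ i)).1), (z (σ i)).2) ∈ D from
            ⟨⟨h4, Metric.ball_subset_closedBall h5⟩, (hzD (σ i)).2⟩)
          simp only [φ, mem_ofPred_eq] at this
          linarith)
      have h5 := mul_nonneg (hapos (σ i)).le h4
      have h6 : ‖nv (σ i)‖ * a (σ i) = 1 - a (σ i) := by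
        have := ha1 (σ i)
        rw [norm_smul, Real.norm_of_nonneg (hapos _).le] at this
        linarith
      change 0 ≤ a (σ i) * (_ + inner ℝ (nv (σ i)) _ + (_ + ‖nv (σ i)‖ * _) * _) at h5
      rw [real_inner_smul_left]
      have h7 : a (σ i) ≤ 1 := by
        have := ha1 (σ i)
        linarith [norm_nonneg (a (σ i) • nv (σ i))]
      -- Since `a ‖nv‖ = 1 - a ≤ 1`, the normalized error is bounded independently of the penalty
      -- weight.
      have h8 : a (σ i) * ((η / N + 2 * ‖(z (σ i)).1 - xb‖ + ‖nv (σ i)‖ * (η / N)) *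
          ‖x - (z (σ i)).1‖) ≤ (2 * (η / N) + 2 * ‖(z (σ i)).1 - xb‖) * ‖x - (z (σ i)).1‖ := by
        have : a (σ i) * (η / N + 2 * ‖(z (σ i)).1 - xb‖ + ‖nv (σ i)‖ * (η / N)) ≤
            2 * (η / N) + 2 * ‖(z (σ i)).1 - xb‖ := by
          have e : a (σ i) * (‖nv (σ i)‖ * (η / N)) = (1 - a (σ i)) * (η / N) := by
            rw [← h6]; ring
          have : 0 ≤ (1 - a (σ i)) * (2 * ‖(z (σ i)).1 - xb‖) :=
            mul_nonneg (by linarith) (by positivity)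
          nlinarith
        rw [← mul_assoc]
        gcongr
      linarith)
    rw [sub_self, norm_zero, mul_zero, add_zero] at h3
    have h4 : 2 * (η / N) * ‖x - xb‖ ≤ η := by
      have : 2 * (η / N) * ‖x - xb‖ = η * ((2 * ‖x - xb‖) / N) := by ring
      rw [this]
      refine mul_le_of_le_one_right hη.le ((div_le_one hN).2 ?_)
      simp only [N]; linarith
    rw [inner_neg_left]
    linarith

end Multipliers

end SampledData

namespace SampledData

open Filter Topology

/-! ### Linearization of flows: initial condition, parameter and final time. -/

section Flow

variable {Z : Type*} [NormedAddCommGroup Z] [NormedSpace ℝ Z] 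

/-- Two integral curves whose velocities are close to each other stay close to each other. -/
lemma norm_sub_le_of_eq_add_integral {φ₁ φ₂ w₁ w₂ : ℝ → Z} {z₁ z₂ : Z} {b L e : ℝ}
    (hL : 0 ≤ L) (he : 0 ≤ e) (hc₁ : ContinuousOn φ₁ (Icc 0 b)) (hc₂ : ContinuousOn φ₂ (Icc 0 b))
    (hw₁ : IntervalIntegrable w₁ volume 0 b) (hw₂ : IntervalIntegrable w₂ volume 0 b)
    (h₁ : ∀ t ∈ Icc 0 b, φ₁ t = z₁ + ∫ s in (0 : ℝ)..t, w₁ s)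
    (h₂ : ∀ t ∈ Icc 0 b, φ₂ t = z₂ + ∫ s in (0 : ℝ)..t, w₂ s)
    (hw : ∀ s ∈ Icc 0 b, ‖w₁ s - w₂ s‖ ≤ L * ‖φ₁ s - φ₂ s‖ + e) :
    ∀ t ∈ Icc 0 b, ‖φ₁ t - φ₂ t‖ ≤ (‖z₁ - z₂‖ + b * e) * Real.exp (L * t) := by
  refine le_mul_exp_of_le_add_integral hL (hc₁.sub hc₂).norm fun t ht => ?_
  have hsub : uIcc 0 t ⊆ uIcc 0 b := by
    rw [uIcc_of_le ht.1, uIcc_of_le (ht.1.trans ht.2)]; exact Icc_subset_Icc_right ht.2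
  have hci : IntervalIntegrable (fun s => ‖φ₁ s - φ₂ s‖) volume 0 t := by
    apply ContinuousOn.intervalIntegrable
    rw [uIcc_of_le ht.1]
    exact (hc₁.sub hc₂).norm.mono (Icc_subset_Icc_right ht.2)
  have e1 : φ₁ t - φ₂ t = (z₁ - z₂) + ∫ s in (0 : ℝ)..t, (w₁ s - w₂ s) := by
    rw [intervalIntegral.integral_sub (hw₁.mono_set hsub) (hw₂.mono_set hsub), h₁ t ht, h₂ t ht]
    abel
  have e2 : ‖∫ s in (0 : ℝ)..t, (w₁ s - w₂ s)‖ ≤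
      ∫ s in (0 : ℝ)..t, (L * ‖φ₁ s - φ₂ s‖ + e) := by
    refine intervalIntegral.norm_integral_le_of_norm_le ht.1 (ae_of_all _ fun s hs => ?_)
      ((hci.const_mul L).add intervalIntegrable_const)
    exact hw s ⟨hs.1.le, hs.2.trans ht.2⟩
  rw [intervalIntegral.integral_add (hci.const_mul L) intervalIntegrable_const,
    intervalIntegral.integral_const_mul, intervalIntegral.integral_const, sub_zero,
    smul_eq_mul] at e2
  rw [e1]
  refine (norm_add_le _ _).trans ?_
  have := mul_le_mul_of_nonneg_right ht.2 he
  linarith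

variable [CompleteSpace Z]

omit [CompleteSpace Z] in
lemma resolvent_intervalIntegrable {C : Set ℝ} (hC : C.Countable) {Λ A : ℝ → Z →L[ℝ] Z} {L : ℝ}
    (hA : ∀ t ∉ C, ContinuousAt A t) (hAL : ∀ t, ‖A t‖ ≤ L) (hΛc : Continuous Λ) (a c : ℝ) :
    IntervalIntegrable (fun s => (Λ s).comp (A s)) volume a c := by
  obtain ⟨B, hB⟩ := isCompact_uIcc.exists_bound_of_continuousOn (s := uIcc a c) hΛc.continuousOn
  refine intervalIntegrable_of_continuousAt_off_countable hC (M := B * L)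
    (fun t ht => hΛc.continuousAt.clm_comp (hA t ht)) fun t ht => ?_
  refine (ContinuousLinearMap.opNorm_comp_le _ _).trans ?_
  gcongr
  exacts [(norm_nonneg _).trans (hB t ht), hB t ht, hAL _]

/-- Solution of the adjoint linear equation `Λ' = -Λ A` with final value the identity. -/
lemma exists_adjoint_resolvent {C : Set ℝ} (hC : C.Countable) {A : ℝ → Z →L[ℝ] Z} {L b : ℝ}
    (hA : ∀ t ∉ C, ContinuousAt A t) (hAL : ∀ t, ‖A t‖ ≤ L) (hb : 0 ≤ b) :
    ∃ Λ : ℝ → Z →L[ℝ] Z, Continuous Λ ∧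
      ∀ t ∈ Icc 0 b, Λ t = 1 + ∫ s in t..b, (Λ s).comp (A s) := by
  have hL : 0 ≤ L := (norm_nonneg _).trans (hAL 0)
  have hC' : ((fun t => b - t) ⁻¹' C).Countable := hC.preimage fun x y h => by simpa using h
  -- The time reversal `t ↦ b - t` turns the final value problem into an initial value problem.
  obtain ⟨M, hMc, hM⟩ := exists_eq_add_integral
    (v := fun t (N : Z →L[ℝ] Z) => N.comp (A (b - t))) hL
    (fun t x y => by
      rw [← ContinuousLinearMap.sub_comp, mul_comm]
      exact (ContinuousLinearMap.opNorm_comp_le _ _).trans (by gcongr; exact hAL _))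
    (fun x hx a c => resolvent_intervalIntegrable hC'
      (fun t ht => ContinuousAt.comp (f := fun t => b - t) (hA _ ht) (by fun_prop))
      (fun t => hAL _) hx a c)
    hb 1
  refine ⟨fun t => M (b - t), hMc.comp (by fun_prop), fun t ht => ?_⟩
  change M (b - t) = _
  rw [hM (b - t) ⟨by linarith [ht.2], by linarith [ht.1]⟩]
  congr 1
  have := intervalIntegral.integral_comp_sub_left
    (fun s => (M s).comp (A (b - s))) b (a := t) (b := b)
  simp only [sub_self, sub_sub_cancel] at this
  exact this.symm

lemma hasDerivAt_adjoint_resolvent {C : Set ℝ} (hC : C.Countable) {A : ℝ → Z →L[ℝ] Z} {L b : ℝ}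
    (hA : ∀ t ∉ C, ContinuousAt A t) (hAL : ∀ t, ‖A t‖ ≤ L)
    {Λ : ℝ → Z →L[ℝ] Z} (hΛc : Continuous Λ)
    (hΛ : ∀ t ∈ Icc 0 b, Λ t = 1 + ∫ s in t..b, (Λ s).comp (A s)) {t : ℝ} (ht : t ∈ Ioo 0 b)
    (htC : t ∉ C) : HasDerivAt Λ (-(Λ t).comp (A t)) t := by
  have hc : ∀ t ∉ C, ContinuousAt (fun s => (Λ s).comp (A s)) t := fun t ht =>
    hΛc.continuousAt.clm_comp (hA t ht)
  have hi := resolvent_intervalIntegrable hC hA hAL hΛc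
  have h1 := ((hasDerivAt_integral_of_continuousAt_off_countable hC hc (hi b t) htC).neg).const_add
    (1 : Z →L[ℝ] Z)
  refine h1.congr_of_eventuallyEq ?_
  filter_upwards [Ioo_mem_nhds ht.1 ht.2] with s hs
  rw [hΛ s (Ioo_subset_Icc_self hs), intervalIntegral.integral_symm]
  rfl

/-- The variation of constants formula, in dual form. -/
lemma eq_adjoint_resolvent_apply_add_integral {C : Set ℝ} (hC : C.Countable)
    {A : ℝ → Z →L[ℝ] Z} {L b : ℝ} (hA : ∀ t ∉ C, ContinuousAt A t) (hAL : ∀ t, ‖A t‖ ≤ L)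
    (hb : 0 ≤ b) {Λ : ℝ → Z →L[ℝ] Z} (hΛc : Continuous Λ)
    (hΛ : ∀ t ∈ Icc 0 b, Λ t = 1 + ∫ s in t..b, (Λ s).comp (A s))
    {d w : ℝ → Z} {M : ℝ} {d₀ : Z} (hd : Continuous d) (hw : ∀ t ∉ C, ContinuousAt w t)
    (hwM : ∀ t, ‖w t‖ ≤ M) (hdw : ∀ t ∈ Icc 0 b, d t = d₀ + ∫ s in (0 : ℝ)..t, w s) :
    d b = Λ 0 d₀ + ∫ s in (0 : ℝ)..b, Λ s (w s - A s (d s)) := by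
  have hL : 0 ≤ L := (norm_nonneg _).trans (hAL 0)
  have hwi : ∀ a c, IntervalIntegrable w volume a c := fun a c =>
    intervalIntegrable_of_continuousAt_off_countable hC hw fun t _ => hwM t
  -- The derivative of `Λ` contributes `-Λ A d`, leaving only the defect of `d` from the linear
  -- equation. Integration up to `b`, where `Λ b = 1`, gives the formula.
  have hder : ∀ t ∈ Ioo 0 b \ C, HasDerivAt (fun s => Λ s (d s)) (Λ t (w t - A t (d t))) t := by
    intro t ht
    have h1 := hasDerivAt_adjoint_resolvent hC hA hAL hΛc hΛ ht.1 ht.2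
    have h2 : HasDerivAt d (w t) t := by
      refine ((hasDerivAt_integral_of_continuousAt_off_countable hC hw
        (hwi 0 t) ht.2).const_add d₀).congr_of_eventuallyEq ?_
      filter_upwards [Ioo_mem_nhds ht.1.1 ht.1.2] with s hs using hdw s (Ioo_subset_Icc_self hs)
    refine (h1.clm_apply h2).congr_deriv ?_
    simp [sub_eq_neg_add]
  have hΛd : Continuous fun s => Λ s (d s) := hΛc.clm_apply hd
  have hint : IntervalIntegrable (fun t => Λ t (w t - A t (d t))) volume 0 b := by
    obtain ⟨B, hB⟩ := isCompact_uIcc.exists_bound_of_continuousOn (s := uIcc 0 b)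
      hΛc.continuousOn
    obtain ⟨B', hB'⟩ := isCompact_uIcc.exists_bound_of_continuousOn (s := uIcc 0 b)
      hd.continuousOn
    refine intervalIntegrable_of_continuousAt_off_countable hC (M := B * (M + L * B'))
      (fun t ht => ?_) fun t ht => ?_
    · exact hΛc.continuousAt.clm_apply ((hw t ht).sub ((hA t ht).clm_apply hd.continuousAt))
    · refine (ContinuousLinearMap.le_opNorm _ _).trans ?_
      have h1 : ‖w t - A t (d t)‖ ≤ M + L * B' := by
        refine (norm_sub_le _ _).trans (add_le_add (hwM t) ?_)
        refine (ContinuousLinearMap.le_opNorm _ _).trans ?_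
        gcongr
        exacts [hAL t, hB' t ht]
      gcongr
      exacts [(norm_nonneg _).trans (hB t ht), hB t ht]
  have key := integral_eq_of_hasDerivAt_off_countable_of_le _ _ hb hC hΛd.continuousOn hder hint
  have hd0 : d 0 = d₀ := by simpa using hdw 0 ⟨le_rfl, hb⟩
  have hΛb : Λ b = 1 := by simpa using hΛ b ⟨hb, le_rfl⟩
  rw [key, hΛb, hd0]
  simp

variable {X : Type*} [NormedAddCommGroup X] [NormedSpace ℝ X]

/-- The hypotheses under which the value at time `b` of the solutions of `z' = F(t, z, x)` is
strictly differentiable with respect to the initial condition, the parameter `x` and the time. -/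
structure ParametricSystem (C : Set ℝ) (L M : ℝ) (F : ℝ → Z → X → Z) : Prop where
  countable : C.Countable
  continuousAt : ∀ t ∉ C, ∀ z x, ContinuousAt (fun p : ℝ × Z × X => F p.1 p.2.1 p.2.2) (t, z, x)
  lipschitz : ∀ t z z' x x', ‖F t z x - F t z' x'‖ ≤ L * (‖z - z'‖ + ‖x - x'‖)
  bounded : ∀ t z x, ‖F t z x‖ ≤ M

/-- `φ` is a family of solutions of `z' = F(t, z, x)` on `[0, b]`, indexed by the initial condition
and the parameter. -/
structure IsFlow (F : ℝ → Z → X → Z) (b : ℝ) (φ : Z × X → ℝ → Z) : Prop where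
  continuous : ∀ y, Continuous (φ y)
  eq_add_integral : ∀ y, ∀ t ∈ Icc 0 b, φ y t = y.1 + ∫ s in (0 : ℝ)..t, F s (φ y s) y.2

variable {C : Set ℝ} {L M b : ℝ} {F : ℝ → Z → X → Z} {φ : Z × X → ℝ → Z}

omit [NormedSpace ℝ Z] [CompleteSpace Z] [NormedSpace ℝ X] in
lemma ParametricSystem.continuousAt_comp (hF : ParametricSystem C L M F) {z : ℝ → Z}
    (hz : Continuous z) (x : X) : ∀ t ∉ C, ContinuousAt (fun s => F s (z s) x) t := fun t ht =>
  ContinuousAt.comp (f := fun s => (s, z s, x)) (hF.continuousAt t ht (z t) x) (by fun_prop)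

omit [NormedSpace ℝ Z] [CompleteSpace Z] [NormedSpace ℝ X] in
lemma ParametricSystem.intervalIntegrable (hF : ParametricSystem C L M F) {z : ℝ → Z}
    (hz : Continuous z) (x : X) (a c : ℝ) :
    IntervalIntegrable (fun s => F s (z s) x) volume a c :=
  intervalIntegrable_of_continuousAt_off_countable hF.countable (hF.continuousAt_comp hz x)
    fun t _ => hF.bounded t _ _

lemma ParametricSystem.exists_isFlow (hF : ParametricSystem C L M F) (hL : 0 ≤ L) (hb : 0 ≤ b) :
    ∃ φ, IsFlow F b φ := by
  have h : ∀ y : Z × X, ∃ z : ℝ → Z, Continuous z ∧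
      ∀ t ∈ Icc 0 b, z t = y.1 + ∫ s in (0 : ℝ)..t, F s (z s) y.2 := fun y =>
    exists_eq_add_integral (v := fun s z => F s z y.2) hL
      (fun t z z' => by simpa using hF.lipschitz t z z' y.2 y.2)
      (fun z hz a c => hF.intervalIntegrable hz _ a c) hb y.1
  choose φ hφ using h
  exact ⟨φ, fun y => (hφ y).1, fun y => (hφ y).2⟩

lemma IsFlow.norm_flow_sub_le (hF : ParametricSystem C L M F) (hL : 0 ≤ L) (hφ : IsFlow F b φ)
    (y y' : Z × X) {t : ℝ} (ht : t ∈ Icc 0 b) :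
    ‖φ y t - φ y' t‖ ≤ (1 + b * L) * Real.exp (L * b) * ‖y - y'‖ := by
  have hb : 0 ≤ b := ht.1.trans ht.2
  have h1 := norm_sub_le_of_eq_add_integral hL (mul_nonneg hL (norm_nonneg (y.2 - y'.2)))
    (hφ.continuous y).continuousOn (hφ.continuous y').continuousOn
    (hF.intervalIntegrable (hφ.continuous y) y.2 0 b)
    (hF.intervalIntegrable (hφ.continuous y') y'.2 0 b)
    (hφ.eq_add_integral y) (hφ.eq_add_integral y')
    (fun s _ => (hF.lipschitz s _ _ _ _).trans_eq (mul_add _ _ _)) t ht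
  refine h1.trans ?_
  have h2 : ‖y.1 - y'.1‖ ≤ ‖y - y'‖ := norm_fst_le (y - y')
  have h3 : ‖y.2 - y'.2‖ ≤ ‖y - y'‖ := norm_snd_le (y - y')
  calc (‖y.1 - y'.1‖ + b * (L * ‖y.2 - y'.2‖)) * Real.exp (L * t)
      ≤ (‖y - y'‖ + b * (L * ‖y - y'‖)) * Real.exp (L * b) := by
        gcongr
        exact ht.2
    _ = _ := by ring

/-- Strict differentiability of the value of the solution at the final time with respect to the
initial condition, the parameter, and the final time. -/
theorem IsFlow.hasStrictFDerivAt (hF : ParametricSystem C L M F) (hL : 0 ≤ L)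
    (hφ : IsFlow F b φ) {y₀ : Z × X} {tf : ℝ} (htf : tf ∈ Ioo 0 b) (htfC : tf ∉ C)
    {A : ℝ → Z →L[ℝ] Z} {B : ℝ → X →L[ℝ] Z}
    (hA : ∀ t ∉ C, ContinuousAt A t) (hAL : ∀ t, ‖A t‖ ≤ L)
    (hB : ∀ t ∉ C, ContinuousAt B t) (hBL : ∀ t, ‖B t‖ ≤ L)
    (hAB : ∀ ε > 0, ∃ δ > 0, ∀ t ∈ Icc 0 tf, ∀ y y' : Z × X, ‖y - (φ y₀ t, y₀.2)‖ < δ →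
      ‖y' - (φ y₀ t, y₀.2)‖ < δ →
      ‖F t y.1 y.2 - F t y'.1 y'.2 - A t (y.1 - y'.1) - B t (y.2 - y'.2)‖ ≤ ε * ‖y - y'‖)
    {Λ : ℝ → Z →L[ℝ] Z} (hΛc : Continuous Λ)
    (hΛ : ∀ t ∈ Icc 0 tf, Λ t = 1 + ∫ s in t..tf, (Λ s).comp (A s)) :
    HasStrictFDerivAt (fun w : (Z × X) × ℝ => φ w.1 w.2)
      (((Λ 0).coprod (∫ s in (0 : ℝ)..tf, (Λ s).comp (B s))).coprod
        (ContinuousLinearMap.toSpanSingleton ℝ (F tf (φ y₀ tf) y₀.2))) (y₀, tf) := by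
  have hb : 0 ≤ b := (htf.1.trans htf.2).le
  set K := (1 + b * L) * Real.exp (L * b) with hK
  have hK0 : 0 ≤ K := by positivity
  have hlip : ∀ y y', ∀ t ∈ Icc 0 b, ‖φ y t - φ y' t‖ ≤ K * ‖y - y'‖ := fun y y' t ht =>
    hφ.norm_flow_sub_le hF hL y y' ht
  have hFi : ∀ y a c, IntervalIntegrable (fun s => F s (φ y s) y.2) volume a c := fun y a c =>
    hF.intervalIntegrable (hφ.continuous y) y.2 a c
  have hFsub : ∀ y y' : Z × X, ∀ s ∈ Icc 0 b,
      ‖F s (φ y s) y.2 - F s (φ y' s) y'.2‖ ≤ L * (K + 1) * ‖y - y'‖ := fun y y' s hs => by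
    refine (hF.lipschitz _ _ _ _ _).trans ?_
    have h3 : ‖y.2 - y'.2‖ ≤ ‖y - y'‖ := norm_snd_le (y - y')
    have := hlip y y' s hs
    rw [mul_assoc]
    refine mul_le_mul_of_nonneg_left ?_ hL
    linarith
  obtain ⟨N, hN⟩ := isCompact_Icc.exists_bound_of_continuousOn (s := Icc 0 tf) hΛc.continuousOn
  have hN0 : 0 ≤ N := (norm_nonneg _).trans (hN 0 ⟨le_rfl, htf.1.le⟩)
  have hΛBi : IntervalIntegrable (fun s => (Λ s).comp (B s)) volume 0 tf := by
    refine intervalIntegrable_of_continuousAt_off_countable hF.countable (M := N * L)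
      (fun t ht => hΛc.continuousAt.clm_comp (hB t ht)) fun t ht => ?_
    rw [uIcc_of_le htf.1.le] at ht
    refine (ContinuousLinearMap.opNorm_comp_le _ _).trans ?_
    gcongr
    exacts [hN t ht, hBL t]
  -- This is where `tf ∉ C` matters: the velocity is continuous at `tf`, jointly in time, initial
  -- condition and parameter.
  have hcont : ContinuousAt (fun p : ℝ × (Z × X) => F p.1 (φ p.2 p.1) p.2.2) (tf, y₀) := by
    refine ContinuousAt.comp (x := (tf, y₀)) (f := fun p : ℝ × (Z × X) => (p.1, φ p.2 p.1, p.2.2))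
      (g := fun p : ℝ × Z × X => F p.1 p.2.1 p.2.2) (hF.continuousAt tf htfC (φ y₀ tf) y₀.2) ?_
    refine continuousAt_fst.prodMk (ContinuousAt.prodMk ?_ (by fun_prop))
    have h1 : ContinuousAt (fun p : ℝ × (Z × X) => φ y₀ p.1) (tf, y₀) :=
      ((hφ.continuous y₀).comp continuous_fst).continuousAt
    have h2 : Tendsto (fun p : ℝ × (Z × X) => φ p.2 p.1 - φ y₀ p.1) (𝓝 (tf, y₀)) (𝓝 0) := by
      have h3 : Tendsto (fun p : ℝ × (Z × X) => K * ‖p.2 - y₀‖) (𝓝 (tf, y₀)) (𝓝 0) := by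
        have : Continuous (fun p : ℝ × (Z × X) => K * ‖p.2 - y₀‖) := by fun_prop
        simpa using this.tendsto (tf, y₀)
      refine squeeze_zero_norm' ?_ h3
      filter_upwards [prod_mem_nhds (Ioo_mem_nhds htf.1 htf.2) univ_mem] with p hp
      exact hlip _ _ _ (Ioo_subset_Icc_self hp.1)
    have h4 := h2.add h1
    simp only [sub_add_cancel, zero_add] at h4
    exact h4
  refine .of_isLittleO (Asymptotics.isLittleO_iff.2 fun c hc => ?_)
  -- The error splits into three parts, each allotted `c / 3`. In the part at fixed time, the
  -- linearization error is integrated over a length `tf`, amplified by `‖Λ‖ ≤ N`, and applied to an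
  -- increment of size at most `(K + 1) ‖y - y'‖`.
  obtain ⟨δ₁, hδ₁, h₁⟩ := hAB (c / 3 / ((tf * N + 1) * (K + 1))) (by have := htf.1; positivity)
  obtain ⟨δ₂, hδ₂, h₂⟩ := Metric.mem_nhds_iff.1
    (hcont (Metric.closedBall_mem_nhds _ (by positivity : 0 < c / 3)))
  obtain ⟨δ₃, hδ₃, h₃⟩ := Metric.mem_nhds_iff.1 (Ioo_mem_nhds htf.1 htf.2)
  set δ := min (min (δ₁ / (K + 1)) δ₂) (min δ₃ (c / 3 / (L * (K + 1) + 1))) with hδ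
  have hδ0 : 0 < δ := by positivity
  filter_upwards [Metric.ball_mem_nhds ((y₀, tf), (y₀, tf)) hδ0]
  rintro ⟨⟨y, t⟩, ⟨y', t'⟩⟩ hp
  rw [mem_ball_iff_norm] at hp
  simp only [Prod.mk_sub_mk, Prod.norm_mk, max_lt_iff] at hp
  obtain ⟨⟨hy, ht⟩, ⟨hy', ht'⟩⟩ := hp
  have hδ1 : δ ≤ δ₁ / (K + 1) := (min_le_left _ _).trans (min_le_left _ _)
  have hδ2 : δ ≤ δ₂ := (min_le_left _ _).trans (min_le_right _ _)
  have hδ3 : δ ≤ δ₃ := (min_le_right _ _).trans (min_le_left _ _)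
  have hδ4 : δ ≤ c / 3 / (L * (K + 1) + 1) := (min_le_right _ _).trans (min_le_right _ _)
  have htb : t ∈ Ioo 0 b := h₃ (by rw [mem_ball_iff_norm]; linarith)
  have htb' : t' ∈ Ioo 0 b := h₃ (by rw [mem_ball_iff_norm]; linarith)
  have hclose : ∀ y : Z × X, ‖y - y₀‖ < δ → ∀ s ∈ Icc 0 tf, ‖(φ y s, y.2) - (φ y₀ s, y₀.2)‖ < δ₁ := by
    intro y hy s hs
    have hy1 : ‖y - y₀‖ < δ₁ / (K + 1) := hy.trans_le hδ1
    rw [lt_div_iff₀ (by positivity)] at hy1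
    rw [Prod.mk_sub_mk, Prod.norm_mk, max_lt_iff]
    have h3 : ‖y.2 - y₀.2‖ ≤ ‖y - y₀‖ := norm_snd_le (y - y₀)
    have h4 := hlip y y₀ s ⟨hs.1, hs.2.trans htf.2.le⟩
    have := norm_nonneg (y - y₀)
    constructor <;> nlinarith
  set Y := ‖y - y'‖
  have hY0 : 0 ≤ Y := norm_nonneg _
  -- the variation at the fixed time `tf`
  have ha : ‖φ y tf - φ y' tf - (Λ 0 (y.1 - y'.1) +
      (∫ s in (0 : ℝ)..tf, (Λ s).comp (B s)) (y.2 - y'.2))‖ ≤ c / 3 * Y := by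
    have hw := fun z : Z × X => hF.continuousAt_comp (hφ.continuous z) z.2
    have key := eq_adjoint_resolvent_apply_add_integral hF.countable hA hAL htf.1.le hΛc hΛ
      (d := fun s => φ y s - φ y' s) (w := fun s => F s (φ y s) y.2 - F s (φ y' s) y'.2)
      (M := M + M) (d₀ := y.1 - y'.1) ((hφ.continuous y).sub (hφ.continuous y'))
      (fun s hs => (hw y s hs).sub (hw y' s hs))
      (fun s => (norm_sub_le _ _).trans (add_le_add (hF.bounded _ _ _) (hF.bounded _ _ _)))
      (fun s hs => by
        have hs' : s ∈ Icc 0 b := ⟨hs.1, hs.2.trans htf.2.le⟩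
        rw [intervalIntegral.integral_sub (hFi y _ _) (hFi y' _ _), hφ.eq_add_integral y s hs',
          hφ.eq_add_integral y' s hs']
        abel)
    have hAi : IntervalIntegrable (fun s => Λ s (F s (φ y s) y.2 - F s (φ y' s) y'.2 -
        A s (φ y s - φ y' s))) volume 0 tf := by
      refine intervalIntegrable_of_continuousAt_off_countable hF.countable
        (M := N * (M + M + L * (K * Y))) (fun t ht => ?_) fun t ht => ?_
      · exact hΛc.continuousAt.clm_apply (((hw y t ht).sub (hw y' t ht)).sub
          ((hA t ht).clm_apply ((hφ.continuous y).sub (hφ.continuous y')).continuousAt))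
      · rw [uIcc_of_le htf.1.le] at ht
        refine (ContinuousLinearMap.le_opNorm _ _).trans ?_
        gcongr
        · exact hN t ht
        · refine (norm_sub_le _ _).trans (add_le_add ((norm_sub_le _ _).trans
            (add_le_add (hF.bounded _ _ _) (hF.bounded _ _ _))) ?_)
          refine (ContinuousLinearMap.le_opNorm _ _).trans ?_
          gcongr
          exacts [hAL t, hlip y y' t ⟨ht.1, ht.2.trans htf.2.le⟩]
    rw [key, ContinuousLinearMap.intervalIntegral_apply hΛBi, add_sub_add_left_eq_sub,
      ← intervalIntegral.integral_sub hAi ⟨hΛBi.1.apply_continuousLinearMap _, hΛBi.2.apply_continuousLinearMap _⟩]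
    refine (intervalIntegral.norm_integral_le_of_norm_le_const
      (C := N * (c / 3 / ((tf * N + 1) * (K + 1)) * ((K + 1) * Y))) fun s hs => ?_).trans ?_
    · rw [uIoc_of_le htf.1.le] at hs
      have hs' := Ioc_subset_Icc_self hs
      rw [ContinuousLinearMap.comp_apply, ← map_sub]
      refine (ContinuousLinearMap.le_opNorm _ _).trans ?_
      refine mul_le_mul (hN s hs') ?_ (norm_nonneg _) hN0
      refine (h₁ s hs' (φ y s, y.2) (φ y' s, y'.2) (hclose y hy s hs') (hclose y' hy' s hs')).trans ?_
      have : ‖(φ y s, y.2) - (φ y' s, y'.2)‖ ≤ (K + 1) * Y := by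
        rw [Prod.mk_sub_mk, Prod.norm_mk, max_le_iff]
        have h3 : ‖y.2 - y'.2‖ ≤ Y := norm_snd_le (y - y')
        have h4 := hlip y y' s ⟨hs'.1, hs'.2.trans htf.2.le⟩
        constructor <;> nlinarith
      have := htf.1
      gcongr
    · rw [sub_zero, abs_of_pos htf.1]
      have : N * (c / 3 / ((tf * N + 1) * (K + 1)) * ((K + 1) * Y)) * tf =
          (tf * N / (tf * N + 1)) * (c / 3 * Y) := by
        have : K + 1 ≠ 0 := by positivity
        have : tf * N + 1 ≠ 0 := by have := htf.1; positivity
        field_simp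
      rw [this]
      refine mul_le_of_le_one_left (by positivity) ((div_le_one ?_).2 (by linarith))
      have := htf.1; positivity
  have hint : ∀ z : Z × X, ∀ s ∈ Icc 0 b, ∀ s' ∈ Icc 0 b,
      φ z s - φ z s' = ∫ r in s'..s, F r (φ z r) z.2 := fun z s hs s' hs' => by
    rw [hφ.eq_add_integral z s hs, hφ.eq_add_integral z s' hs', add_sub_add_left_eq_sub,
      intervalIntegral.integral_interval_sub_left (hFi z _ _) (hFi z _ _)]
  have hfb := Ioo_subset_Icc_self htf
  have htb1 := Ioo_subset_Icc_self htb
  have htb1' := Ioo_subset_Icc_self htb'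
  -- the variation of the difference of the two solutions between `tf` and `t'`
  have hbb : ‖(φ y t' - φ y tf) - (φ y' t' - φ y' tf)‖ ≤ c / 3 * Y := by
    rw [hint y _ htb1' _ hfb, hint y' _ htb1' _ hfb,
      ← intervalIntegral.integral_sub (hFi y _ _) (hFi y' _ _)]
    refine (intervalIntegral.norm_integral_le_of_norm_le_const (C := L * (K + 1) * Y)
      fun s hs => hFsub y y' s (uIcc_subset_Icc hfb htb1' (uIoc_subset_uIcc hs))).trans ?_
    have h5 : |t' - tf| ≤ c / 3 / (L * (K + 1) + 1) := (ht'.trans_le hδ4).le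
    rw [le_div_iff₀ (by positivity)] at h5
    have h6 : L * (K + 1) * |t' - tf| ≤ c / 3 := by nlinarith [abs_nonneg (t' - tf)]
    nlinarith
  -- the variation of the time along the first solution
  have hcc : ‖φ y t - φ y t' - (t - t') • F tf (φ y₀ tf) y₀.2‖ ≤ c / 3 * ‖t - t'‖ := by
    rw [hint y _ htb1 _ htb1', ← intervalIntegral.integral_const,
      ← intervalIntegral.integral_sub (hFi y _ _) intervalIntegrable_const]
    refine intervalIntegral.norm_integral_le_of_norm_le_const fun s hs => ?_
    have hs1 : s ∈ Metric.ball tf δ₂ := by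
      refine (convex_ball tf δ₂).ordConnected.uIcc_subset ?_ ?_ (uIoc_subset_uIcc hs) <;>
      rw [mem_ball_iff_norm] <;> linarith
    have := h₂ (show (s, y) ∈ Metric.ball (tf, y₀) δ₂ by
      rw [← ball_prod_same]
      exact ⟨hs1, by rw [mem_ball_iff_norm]; linarith⟩)
    rw [mem_preimage, mem_closedBall_iff_norm] at this
    exact this
  simp only [Prod.mk_sub_mk, ContinuousLinearMap.coprod_apply,
    ContinuousLinearMap.toSpanSingleton_apply, Prod.fst_sub, Prod.snd_sub]
  have hfin : φ y t - φ y' t' - (Λ 0 (y.1 - y'.1) +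
      (∫ s in (0 : ℝ)..tf, (Λ s).comp (B s)) (y.2 - y'.2) +
      (t - t') • F tf (φ y₀ tf) y₀.2) =
      (φ y tf - φ y' tf - (Λ 0 (y.1 - y'.1) +
        (∫ s in (0 : ℝ)..tf, (Λ s).comp (B s)) (y.2 - y'.2))) +
      ((φ y t' - φ y tf) - (φ y' t' - φ y' tf)) +
      (φ y t - φ y t' - (t - t') • F tf (φ y₀ tf) y₀.2) := by abel
  rw [hfin]
  refine (norm_add₃_le).trans ?_
  have h7 : Y ≤ ‖(y - y', t - t')‖ := norm_fst_le (y - y', t - t')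
  have h8 : ‖t - t'‖ ≤ ‖(y - y', t - t')‖ := norm_snd_le (y - y', t - t')
  nlinarith

end Flow

end SampledData

namespace SampledData

open Filter Topology

/-! ### Truncation of the field outside a ball. -/

section Truncation

variable {W V : Type*} [NormedAddCommGroup W] [NormedSpace ℝ W]
  [NormedAddCommGroup V] [NormedSpace ℝ V]

/-- A bounded time-dependent field, Lipschitz and strictly differentiable uniformly in time. -/
structure IsUniformlyC1 (h : ℝ → W → V) (Dh : ℝ → W → W →L[ℝ] V) (L M : ℝ) : Prop where
  continuous : Continuous fun p : ℝ × W => h p.1 p.2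
  continuous_deriv : Continuous fun p : ℝ × W => Dh p.1 p.2
  bounded : ∀ t w, ‖h t w‖ ≤ M
  bounded_deriv : ∀ t w, ‖Dh t w‖ ≤ L
  lipschitz : ∀ t w w', ‖h t w - h t w'‖ ≤ L * ‖w - w'‖
  strict : ∀ ε > 0, ∃ δ > 0, ∀ t w₀ w w', ‖w - w₀‖ < δ → ‖w' - w₀‖ < δ →
    ‖h t w - h t w' - Dh t w₀ (w - w')‖ ≤ ε * ‖w - w'‖

/-- A field that is continuous in time and continuously differentiable in space coincides, on a
bounded time interval and on a ball, with a bounded field that is uniformly `C¹`. -/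
theorem exists_isUniformlyC1_eqOn_ball [FiniteDimensional ℝ W] {f : ℝ → W → V}
    {Df : ℝ → W → W →L[ℝ] V}
    (hf : Continuous fun p : ℝ × W => f p.1 p.2) (hDf : Continuous fun p : ℝ × W => Df p.1 p.2)
    (hd : ∀ t w, HasFDerivAt (f t) (Df t w) w) {b R : ℝ} (hb : 0 ≤ b) (hR : 0 < R) :
    ∃ (h : ℝ → W → V) (Dh : ℝ → W → W →L[ℝ] V) (L M : ℝ), 0 ≤ L ∧ IsUniformlyC1 h Dh L M ∧
      ∀ t ∈ Icc 0 b, ∀ w, ‖w‖ < R → h t w = f t w ∧ Dh t w = Df t w := by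
  let χ : ContDiffBump (0 : W) := ⟨R, R + 1, hR, by linarith⟩
  have hχd : ∀ w, HasFDerivAt χ (fderiv ℝ χ w) w := fun w =>
    ((χ.contDiff (n := 1)).differentiable (by simp) w).hasFDerivAt
  have hχc : Continuous (fderiv ℝ χ) := (χ.contDiff (n := 1)).continuous_fderiv (by simp)
  -- Restricting time to `[0, b]` makes `g` and its differential compactly supported, hence bounded,
  -- with uniformly continuous differential. Times outside `[0, b]` are then projected onto it.
  let g : Icc (0 : ℝ) b × W → V := fun p => χ p.2 • f p.1 p.2
  let Dg : Icc (0 : ℝ) b × W → W →L[ℝ] V := fun p =>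
    χ p.2 • Df p.1 p.2 + (fderiv ℝ χ p.2).smulRight (f p.1 p.2)
  have hgd : ∀ t w, HasFDerivAt (fun w => g (t, w)) (Dg (t, w)) w := fun t w =>
    (hχd w).smul (hd t w)
  have hι : Continuous fun p : Icc (0 : ℝ) b × W => ((p.1 : ℝ), p.2) := by fun_prop
  have hf' : Continuous fun p : Icc (0 : ℝ) b × W => f p.1 p.2 := hf.comp hι
  have hDf' : Continuous fun p : Icc (0 : ℝ) b × W => Df p.1 p.2 := hDf.comp hι
  have hχ2 : Continuous fun p : Icc (0 : ℝ) b × W => χ p.2 := χ.continuous.comp continuous_snd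
  have hχ2' : Continuous fun p : Icc (0 : ℝ) b × W => fderiv ℝ χ p.2 := hχc.comp continuous_snd
  have hgc : Continuous g := hχ2.smul hf'
  have hDgc : Continuous Dg := (hχ2.smul hDf').add (((ContinuousLinearMap.smulRightL ℝ W V).continuous.comp hχ2').clm_apply hf')
  have : ProperSpace W := FiniteDimensional.proper_real W
  have hK : IsCompact ((univ : Set (Icc (0 : ℝ) b)) ×ˢ tsupport χ) :=
    isCompact_univ.prod χ.hasCompactSupport
  have hgs : HasCompactSupport g := HasCompactSupport.intro hK fun p hp => by
    have hp' : p.2 ∉ tsupport χ := fun h => hp ⟨mem_univ _, h⟩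
    simp [g, image_eq_zero_of_notMem_tsupport hp']
  have hDgs : HasCompactSupport Dg := HasCompactSupport.intro hK fun p hp => by
    have hp' : p.2 ∉ tsupport χ := fun h => hp ⟨mem_univ _, h⟩
    have hp'' : fderiv ℝ χ p.2 = 0 :=
      image_eq_zero_of_notMem_tsupport fun h => hp' (tsupport_fderiv_subset ℝ h)
    simp [Dg, image_eq_zero_of_notMem_tsupport hp', hp'']
  obtain ⟨M, hM⟩ := hgs.exists_bound_of_continuous hgc
  obtain ⟨L, hL⟩ := hDgs.exists_bound_of_continuous hDgc
  have hDgu := hDgs.uniformContinuous_of_continuous hDgc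
  have hproj : Continuous fun p : ℝ × W => (projIcc 0 b hb p.1, p.2) :=
    (continuous_projIcc.comp continuous_fst).prodMk continuous_snd
  refine ⟨fun t w => g (projIcc 0 b hb t, w), fun t w => Dg (projIcc 0 b hb t, w), L, M,
    (norm_nonneg _).trans (hL (projIcc 0 b hb 0, 0)),
    ⟨hgc.comp hproj, hDgc.comp hproj, fun t w => hM _, fun t w => hL _, fun t w w' => ?_,
      fun ε hε => ?_⟩, fun t ht w hw => ?_⟩
  · exact convex_univ.norm_image_sub_le_of_norm_hasFDerivWithin_le
      (f := fun w => g (projIcc 0 b hb t, w)) (fun x _ => (hgd _ x).hasFDerivWithinAt)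
      (fun x _ => hL _) (mem_univ _) (mem_univ _)
  · obtain ⟨δ, hδ, H⟩ := Metric.uniformContinuous_iff.1 hDgu ε hε
    refine ⟨δ, hδ, fun t w₀ w w' hw hw' => ?_⟩
    refine (convex_ball w₀ δ).norm_image_sub_le_of_norm_hasFDerivWithin_le'
      (f := fun w => g (projIcc 0 b hb t, w)) (fun x _ => (hgd _ x).hasFDerivWithinAt)
      (fun x hx => ?_) (mem_ball_iff_norm.2 hw') (mem_ball_iff_norm.2 hw)
    rw [← dist_eq_norm]
    refine (H ?_).le
    rw [Prod.dist_eq, dist_self]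
    exact max_lt hδ hx
  · have hw' : w ∈ Metric.ball (0 : W) χ.rIn := by simpa [χ] using hw
    have h1 : χ w = 1 := χ.one_of_mem_closedBall (Metric.ball_subset_closedBall hw')
    have h2 : fderiv ℝ χ w = 0 := by
      have := (χ.eventuallyEq_one_of_mem_ball hw').fderiv_eq (𝕜 := ℝ)
      rw [this]
      exact fderiv_const_apply (1 : ℝ)
    simp [g, Dg, h1, h2, projIcc_of_mem hb ht]

end Truncation

/-! ### The augmented system driven by finitely many control values. -/

section SampleAndHold

/-- The index of the sampling interval that contains `t`, the last one being extended to `+∞`. -/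
noncomputable def holdIndex (T : ℝ) (K : ℕ) (t : ℝ) : Fin (K + 1) :=
  ⟨min ⌊t / T⌋₊ K, Nat.lt_succ_of_le (min_le_right _ _)⟩

/-- The sampling times `0, T, …, K T`. -/
noncomputable def samplingTimes (T : ℝ) (K : ℕ) : Set ℝ := {t | ∃ k ≤ K, t = (k : ℝ) * T}

lemma countable_samplingTimes (T : ℝ) (K : ℕ) : (samplingTimes T K).Countable := by
  refine (countable_range fun k : ℕ => (k : ℝ) * T).mono ?_
  rintro t ⟨k, -, rfl⟩
  exact ⟨k, rfl⟩

lemma holdIndex_eq_of_mem_Ico {T : ℝ} (hT : 0 < T) {K k : ℕ} (hk : k ≤ K) {t : ℝ}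
    (ht : t ∈ Ico ((k : ℝ) * T) (((k : ℝ) + 1) * T)) : (holdIndex T K t : ℕ) = k := by
  have : ⌊t / T⌋₊ = k := by
    rw [Nat.floor_eq_iff (div_nonneg (le_trans (by positivity) ht.1) hT.le)]
    exact ⟨(le_div_iff₀ hT).2 ht.1, (div_lt_iff₀ hT).2 ht.2⟩
  simp [holdIndex, this, hk]

lemma holdIndex_eq_last {T : ℝ} (hT : 0 < T) {K : ℕ} {t : ℝ} (ht : (K : ℝ) * T ≤ t) :
    (holdIndex T K t : ℕ) = K := by
  have : K ≤ ⌊t / T⌋₊ := Nat.le_floor ((le_div_iff₀ hT).2 ht)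
  simp [holdIndex, this]

/-- The index jumps at most at `0, T, …, K T`. As the last interval is unbounded, `(K + 1) T` is a
point of continuity even though it is a controlling time. -/
lemma holdIndex_eventuallyEq {T : ℝ} (hT : 0 < T) {K : ℕ} {t : ℝ} (ht : t ∉ samplingTimes T K) :
    ∀ᶠ s in 𝓝 t, holdIndex T K s = holdIndex T K t := by
  rcases lt_or_ge t 0 with h0 | h0
  · have h : ∀ s < 0, holdIndex T K s = 0 := fun s hs => by
      have : ⌊s / T⌋₊ = 0 := Nat.floor_of_nonpos (div_nonpos_of_nonpos_of_nonneg hs.le hT.le)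
      ext; simp [holdIndex, this]
    filter_upwards [Iio_mem_nhds h0] with s hs
    rw [h s hs, h t h0]
  rcases lt_or_ge ((K : ℝ) * T) t with hK | hK
  · filter_upwards [Ioi_mem_nhds hK] with s hs
    ext
    rw [holdIndex_eq_last hT hs.le, holdIndex_eq_last hT hK.le]
  set k := ⌊t / T⌋₊ with hk
  have h1 : (k : ℝ) * T ≤ t := (le_div_iff₀ hT).1 (Nat.floor_le (div_nonneg h0 hT.le))
  have h2 : t < ((k : ℝ) + 1) * T := (div_lt_iff₀ hT).1 (Nat.lt_floor_add_one _)
  have hkK : k ≤ K := by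
    have : (k : ℝ) * T ≤ K * T := h1.trans hK
    exact_mod_cast le_of_mul_le_mul_right this hT
  have h3 : (k : ℝ) * T < t := lt_of_le_of_ne h1 fun h => ht ⟨k, hkK, h.symm⟩
  filter_upwards [Ioo_mem_nhds h3 h2] with s hs
  ext
  rw [holdIndex_eq_of_mem_Ico hT hkK (Ioo_subset_Ico_self hs), holdIndex_eq_of_mem_Ico hT hkK ⟨h1, h2⟩]

variable {Q U : Type*} [NormedAddCommGroup Q] [NormedSpace ℝ Q] [NormedAddCommGroup U]
  [NormedSpace ℝ U]

/-- The sampled-data control system driven by `h`, in the state augmented by the cost. -/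
noncomputable def augmentedSystem (T : ℝ) (K : ℕ) (h : ℝ → Q × U → Q × ℝ) (t : ℝ) (z : Q × ℝ)
    (x : Fin (K + 1) → U) : Q × ℝ :=
  h t (z.1, x (holdIndex T K t))

/-- Partial differential of the augmented system with respect to the state. -/
noncomputable def stateDeriv (D : Q × U →L[ℝ] Q × ℝ) : Q × ℝ →L[ℝ] Q × ℝ :=
  D.comp ((ContinuousLinearMap.inl ℝ Q U).comp (ContinuousLinearMap.fst ℝ Q ℝ))

/-- Partial differential of the augmented system with respect to the sampled-data control. -/
noncomputable def controlDeriv (T : ℝ) (K : ℕ) (D : Q × U →L[ℝ] Q × ℝ) (t : ℝ) :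
    (Fin (K + 1) → U) →L[ℝ] Q × ℝ :=
  D.comp ((ContinuousLinearMap.inr ℝ Q U).comp
    (ContinuousLinearMap.proj (R := ℝ) (φ := fun _ : Fin (K + 1) => U) (holdIndex T K t)))

@[simp] lemma stateDeriv_apply (D : Q × U →L[ℝ] Q × ℝ) (z : Q × ℝ) :
    stateDeriv D z = D (z.1, 0) := rfl

@[simp] lemma controlDeriv_apply (T : ℝ) (K : ℕ) (D : Q × U →L[ℝ] Q × ℝ) (t : ℝ)
    (x : Fin (K + 1) → U) : controlDeriv T K D t x = D (0, x (holdIndex T K t)) := rfl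

lemma norm_stateDeriv_le (D : Q × U →L[ℝ] Q × ℝ) : ‖stateDeriv D‖ ≤ ‖D‖ := by
  refine ContinuousLinearMap.opNorm_le_bound _ (norm_nonneg _) fun z => ?_
  rw [stateDeriv_apply]
  refine (D.le_opNorm _).trans ?_
  gcongr
  simpa using norm_fst_le z

lemma norm_controlDeriv_le (T : ℝ) (K : ℕ) (D : Q × U →L[ℝ] Q × ℝ) (t : ℝ) :
    ‖controlDeriv T K D t‖ ≤ ‖D‖ := by
  refine ContinuousLinearMap.opNorm_le_bound _ (norm_nonneg _) fun x => ?_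
  rw [controlDeriv_apply]
  refine (D.le_opNorm _).trans ?_
  gcongr
  simpa using norm_le_pi_norm x _

variable {T : ℝ} {K : ℕ} {h : ℝ → Q × U → Q × ℝ} {Dh : ℝ → Q × U → Q × U →L[ℝ] Q × ℝ} {L M : ℝ}

lemma IsUniformlyC1.parametricSystem (hT : 0 < T) (hL : 0 ≤ L) (hh : IsUniformlyC1 h Dh L M) :
    ParametricSystem (samplingTimes T K) L M (augmentedSystem T K h) where
  countable := countable_samplingTimes T K
  continuousAt t ht z x := by
    have h1 : Continuous fun p : ℝ × (Q × ℝ) × (Fin (K + 1) → U) =>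
        h p.1 (p.2.1.1, p.2.2 (holdIndex T K t)) :=
      hh.continuous.comp (f := fun p : ℝ × (Q × ℝ) × (Fin (K + 1) → U) =>
        (p.1, (p.2.1.1, p.2.2 (holdIndex T K t)))) (by fun_prop)
    refine h1.continuousAt.congr ?_
    have := (continuous_fst (X := ℝ) (Y := (Q × ℝ) × (Fin (K + 1) → U))).tendsto (t, z, x)
    filter_upwards [this.eventually (holdIndex_eventuallyEq hT ht)] with p hp
    simp only [augmentedSystem, hp]
  lipschitz t z z' x x' := by
    refine (hh.lipschitz _ _ _).trans ?_
    gcongr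
    rw [Prod.mk_sub_mk, Prod.norm_mk]
    have h1 : ‖z.1 - z'.1‖ ≤ ‖z - z'‖ := norm_fst_le (z - z')
    have h2 : ‖x (holdIndex T K t) - x' (holdIndex T K t)‖ ≤ ‖x - x'‖ := norm_le_pi_norm (x - x') _
    refine max_le ?_ ?_ <;> linarith [norm_nonneg (z - z'), norm_nonneg (x - x')]
  bounded t z x := hh.bounded _ _

lemma IsUniformlyC1.continuousAt_deriv (hT : 0 < T) (hh : IsUniformlyC1 h Dh L M) {q : ℝ → Q}
    (hq : Continuous q) (x : Fin (K + 1) → U) {t : ℝ} (ht : t ∉ samplingTimes T K) :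
    ContinuousAt (fun s => Dh s (q s, x (holdIndex T K s))) t := by
  have h1 : Continuous fun s => Dh s (q s, x (holdIndex T K t)) :=
    hh.continuous_deriv.comp (f := fun s => (s, (q s, x (holdIndex T K t)))) (by fun_prop)
  refine h1.continuousAt.congr ?_
  filter_upwards [holdIndex_eventuallyEq hT ht] with s hs
  rw [hs]

lemma continuousAt_controlDeriv (hT : 0 < T) {D : ℝ → Q × U →L[ℝ] Q × ℝ} {t : ℝ}
    (hD : ContinuousAt D t) (ht : t ∉ samplingTimes T K) :
    ContinuousAt (fun s => controlDeriv T K (D s) s) t := by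
  refine (hD.clm_comp (continuousAt_const
    (y := (ContinuousLinearMap.inr ℝ Q U).comp (ContinuousLinearMap.proj (R := ℝ)
      (φ := fun _ : Fin (K + 1) => U) (holdIndex T K t))))).congr ?_
  filter_upwards [holdIndex_eventuallyEq hT ht] with s hs
  simp only [controlDeriv, hs]

/-- The radius given by `hh.strict` depends neither on time nor on the base point, so it serves
along a whole curve. -/
lemma IsUniformlyC1.strict_augmentedSystem (hh : IsUniformlyC1 h Dh L M)
    {z₀ : ℝ → Q × ℝ} {x₀ : Fin (K + 1) → U} {ε : ℝ} (hε : 0 < ε) :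
    ∃ δ > 0, ∀ t, ∀ y y' : (Q × ℝ) × (Fin (K + 1) → U), ‖y - (z₀ t, x₀)‖ < δ →
      ‖y' - (z₀ t, x₀)‖ < δ →
      ‖augmentedSystem T K h t y.1 y.2 - augmentedSystem T K h t y'.1 y'.2 -
        stateDeriv (Dh t ((z₀ t).1, x₀ (holdIndex T K t))) (y.1 - y'.1) -
        controlDeriv T K (Dh t ((z₀ t).1, x₀ (holdIndex T K t))) t (y.2 - y'.2)‖ ≤
      ε * ‖y - y'‖ := by
  obtain ⟨δ, hδ, H⟩ := hh.strict ε hε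
  have hle : ∀ (y y' : (Q × ℝ) × (Fin (K + 1) → U)) (i : Fin (K + 1)),
      ‖(y.1.1, y.2 i) - (y'.1.1, y'.2 i)‖ ≤ ‖y - y'‖ := fun y y' i => by
    rw [Prod.mk_sub_mk, Prod.norm_mk]
    have h1 : ‖y.1.1 - y'.1.1‖ ≤ ‖y.1 - y'.1‖ := norm_fst_le (y.1 - y'.1)
    have h2 : ‖y.2 i - y'.2 i‖ ≤ ‖y.2 - y'.2‖ := norm_le_pi_norm (y.2 - y'.2) _
    exact max_le (h1.trans (norm_fst_le (y - y'))) (h2.trans (norm_snd_le (y - y')))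
  refine ⟨δ, hδ, fun t y y' hy hy' => ?_⟩
  have key := H t ((z₀ t).1, x₀ (holdIndex T K t)) (y.1.1, y.2 (holdIndex T K t))
    (y'.1.1, y'.2 (holdIndex T K t))
    ((hle y (z₀ t, x₀) _).trans_lt hy) ((hle y' (z₀ t, x₀) _).trans_lt hy')
  refine le_trans (le_of_eq ?_) (key.trans (mul_le_mul_of_nonneg_left (hle y y' _) hε.le))
  rw [stateDeriv_apply, controlDeriv_apply, sub_sub, ← map_add]
  simp [augmentedSystem]

end SampleAndHold

end SampledData

/-! ### The Hamiltonian, and the correspondence between trajectories and the truncated flow. -/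

namespace SampledData

open Filter Topology

lemma gradient_eq_toDual_symm_of_hasFDerivAt {F : Type*} [NormedAddCommGroup F]
    [InnerProductSpace ℝ F] [CompleteSpace F] {f : F → ℝ} {f' : F →L[ℝ] ℝ} {x : F}
    (h : HasFDerivAt f f' x) : gradient f x = (InnerProductSpace.toDual ℝ F).symm f' := by
  rw [gradient, h.fderiv]

/-- A control defined on the first sampling intervals is extended by its last value. -/
def extendControl {m K : ℕ} (x : Fin (K + 1) → E m) (k : ℕ) : E m :=
  x ⟨min k K, Nat.lt_succ_of_le (min_le_right _ _)⟩

namespace Problem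

variable {n m j : ℕ} (P : Problem n m j)

/-- The dynamics and the running cost, as a single field. -/
def augField (t : ℝ) (w : E n × E m) : E n × ℝ := (P.f t w.1 w.2, P.f₀ t w.1 w.2)

/-- The differential of `augField` with respect to the state and the control. -/
noncomputable def augFieldDeriv (t : ℝ) (w : E n × E m) : E n × E m →L[ℝ] E n × ℝ :=
  (fderiv ℝ (fun x : E n × E m => P.f t x.1 x.2) w).prod
    (fderiv ℝ (fun x : E n × E m => P.f₀ t x.1 x.2) w)

variable {P}

lemma continuous_augField (hf : IsC1InStateControl P.f) (hf₀ : IsC1InStateControl P.f₀) :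
    Continuous fun p : ℝ × E n × E m => P.augField p.1 p.2 :=
  hf.1.prodMk hf₀.1

lemma continuous_augFieldDeriv (hf : IsC1InStateControl P.f) (hf₀ : IsC1InStateControl P.f₀) :
    Continuous fun p : ℝ × E n × E m => P.augFieldDeriv p.1 p.2 :=
  (ContinuousLinearMap.prodₗᵢ ℝ).continuous.comp (hf.2.2.prodMk hf₀.2.2)

lemma hasFDerivAt_augField (hf : IsC1InStateControl P.f) (hf₀ : IsC1InStateControl P.f₀) (t : ℝ)
    (w : E n × E m) : HasFDerivAt (P.augField t) (P.augFieldDeriv t w) w :=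
  (hf.2.1 t w).hasFDerivAt.prodMk (hf₀.2.1 t w).hasFDerivAt

lemma hold_extendControl {K : ℕ} (x : Fin (K + 1) → E m) (t : ℝ) :
    P.hold (extendControl x) t = x (holdIndex P.T K t) := rfl

lemma hold_eq_of_lt (hT : 0 < P.T) {K : ℕ} (u : ℕ → E m) {t : ℝ} (h0 : 0 ≤ t)
    (ht : t < ((K : ℝ) + 1) * P.T) : P.hold u t = u (holdIndex P.T K t) := by
  have : ⌊t / P.T⌋₊ < K + 1 := by
    rw [Nat.floor_lt (div_nonneg h0 hT.le), div_lt_iff₀ hT]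
    exact_mod_cast ht
  simp [hold, holdIndex, Nat.lt_succ_iff.1 this]

/-- The inequality is strict because the index is lowered when `tf` is a controlling time. Hence
`tf` is never one of the times `0, …, K T` at which the velocity may jump. -/
lemma lastIndex_mul_lt (hT : 0 < P.T) {tf : ℝ} (htf : 0 < tf) : (P.lastIndex tf : ℝ) * P.T < tf := by
  unfold lastIndex
  split_ifs with h
  · obtain ⟨k, rfl⟩ := h
    rw [mul_div_cancel_right₀ _ hT.ne', Nat.floor_natCast]
    have hk : k ≠ 0 := by rintro rfl; simp at htf
    have : ((k - 1 : ℕ) : ℝ) < k := by exact_mod_cast Nat.sub_one_lt hk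
    exact mul_lt_mul_of_pos_right this hT
  · refine lt_of_le_of_ne ((le_div_iff₀ hT).1 (Nat.floor_le (div_nonneg htf.le hT.le))) fun h' => ?_
    exact h ⟨_, h'.symm⟩

lemma le_lastIndex_add_one_mul (hT : 0 < P.T) {tf : ℝ} (htf : 0 < tf) :
    tf ≤ ((P.lastIndex tf : ℝ) + 1) * P.T := by
  unfold lastIndex
  split_ifs with h
  · obtain ⟨k, rfl⟩ := h
    rw [mul_div_cancel_right₀ _ hT.ne', Nat.floor_natCast]
    have hk : k ≠ 0 := by rintro rfl; simp at htf
    have : ((k - 1 : ℕ) : ℝ) + 1 = k := by exact_mod_cast Nat.sub_add_cancel (Nat.pos_of_ne_zero hk)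
    rw [this]
  · exact (div_le_iff₀ hT).1 (Nat.lt_floor_add_one _).le

/-- The linear form `(v, r) ↦ ⟨p, v⟩ + p⁰ r`. -/
noncomputable def covector (p : E n) (p₀ : ℝ) : E n × ℝ →L[ℝ] ℝ :=
  (innerSL ℝ p).coprod (p₀ • ContinuousLinearMap.id ℝ ℝ)

@[simp] lemma covector_apply (p : E n) (p₀ : ℝ) (z : E n × ℝ) :
    covector p p₀ z = inner ℝ p z.1 + p₀ * z.2 := by
  simp [covector]

/-- Thanks to this form, the gradients of `H` in the state and in the control are pull-backs of one
covector by the differential of the augmented field. -/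
lemma H_eq_covector (t : ℝ) (q p : E n) (p₀ : ℝ) (u : E m) :
    P.H t q p p₀ u = covector p p₀ (P.augField t (q, u)) := by
  simp [H, augField]

lemma gradAdjointH_eq (t : ℝ) (q p : E n) (p₀ : ℝ) (u : E m) :
    P.gradAdjointH t q p p₀ u = P.f t q u := by
  have : HasFDerivAt (fun x => P.H t q x p₀ u) (innerSL ℝ (P.f t q u)) p := by
    have h := ((innerSL ℝ (P.f t q u)).hasFDerivAt (x := p)).add_const (p₀ * P.f₀ t q u)
    refine h.congr_of_eventuallyEq (Eventually.of_forall fun x => ?_)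
    simp [H, real_inner_comm]
  rw [gradAdjointH, gradient_eq_toDual_symm_of_hasFDerivAt this]
  exact (InnerProductSpace.toDual ℝ (E n)).symm_apply_apply _

lemma gradStateH_eq (hf : IsC1InStateControl P.f) (hf₀ : IsC1InStateControl P.f₀)
    (t : ℝ) (q p : E n) (p₀ : ℝ) (u : E m) :
    P.gradStateH t q p p₀ u = (InnerProductSpace.toDual ℝ (E n)).symm
      ((covector p p₀).comp ((P.augFieldDeriv t (q, u)).comp (ContinuousLinearMap.inl ℝ _ _))) := by
  refine gradient_eq_toDual_symm_of_hasFDerivAt ?_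
  have h := (covector p p₀).hasFDerivAt.comp q
    ((hasFDerivAt_augField hf hf₀ t (q, u)).comp q (hasFDerivAt_prodMk_left q u))
  refine h.congr_of_eventuallyEq (Eventually.of_forall fun x => ?_)
  exact H_eq_covector _ _ _ _ _

lemma gradControlH_eq (hf : IsC1InStateControl P.f) (hf₀ : IsC1InStateControl P.f₀)
    (t : ℝ) (q p : E n) (p₀ : ℝ) (u : E m) :
    P.gradControlH t q p p₀ u = (InnerProductSpace.toDual ℝ (E m)).symm
      ((covector p p₀).comp ((P.augFieldDeriv t (q, u)).comp (ContinuousLinearMap.inr ℝ _ _))) := by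
  refine gradient_eq_toDual_symm_of_hasFDerivAt ?_
  have h := (covector p p₀).hasFDerivAt.comp u
    ((hasFDerivAt_augField hf hf₀ t (q, u)).comp u (hasFDerivAt_prodMk_right q u))
  refine h.congr_of_eventuallyEq (Eventually.of_forall fun x => ?_)
  exact H_eq_covector _ _ _ _ _

variable {K : ℕ} {h : ℝ → E n × E m → E n × ℝ} {Dh : ℝ → E n × E m → E n × E m →L[ℝ] E n × ℝ}
  {L M b R : ℝ} {φ : (E n × ℝ) × (Fin (K + 1) → E m) → ℝ → E n × ℝ}

/-- The solutions of the truncated system that stay in the region where it coincides with the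
original one are trajectories, and their last component is the cost. -/
lemma isTrajectory_and_cost_eq_of_isFlow (hT : 0 < P.T) (hL : 0 ≤ L)
    (hh : IsUniformlyC1 h Dh L M) (hφ : IsFlow (augmentedSystem P.T K h) b φ)
    (heq : ∀ t ∈ Icc 0 b, ∀ w, ‖w‖ < R → h t w = P.augField t w)
    {y : (E n × ℝ) × (Fin (K + 1) → E m)} (hy : y.1.2 = 0) {tf : ℝ} (htf : tf ∈ Icc 0 b)
    (hRq : ∀ s ∈ Icc 0 tf, ‖(φ y s).1‖ < R) (hRu : ∀ i, ‖y.2 i‖ < R) :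
    P.IsTrajectory tf (extendControl y.2) (fun s => (φ y s).1) ∧
      P.cost tf (extendControl y.2) (fun s => (φ y s).1) = (φ y tf).2 := by
  have hsys := hh.parametricSystem (K := K) hT hL
  have hi : ∀ a c, IntervalIntegrable (fun s => augmentedSystem P.T K h s (φ y s) y.2) volume a c :=
    hsys.intervalIntegrable (hφ.continuous y) y.2
  have hval : ∀ s ∈ Icc 0 tf, augmentedSystem P.T K h s (φ y s) y.2 =
      P.augField s ((φ y s).1, P.hold (extendControl y.2) s) := fun s hs => by
    rw [hold_extendControl]
    exact heq s ⟨hs.1, hs.2.trans htf.2⟩ _ (max_lt (hRq s hs) (hRu _))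
  refine ⟨⟨?_, ?_⟩, ?_⟩
  · refine LipschitzOnWith.absolutelyContinuousOnInterval (K := ⟨|M|, abs_nonneg M⟩) ?_
    refine LipschitzOnWith.of_dist_le_mul fun s hs s' hs' => ?_
    rw [uIcc_of_le htf.1] at hs hs'
    rw [dist_eq_norm, ← Prod.fst_sub]
    refine (norm_fst_le _).trans ?_
    rw [hφ.eq_add_integral y s ⟨hs.1, hs.2.trans htf.2⟩,
      hφ.eq_add_integral y s' ⟨hs'.1, hs'.2.trans htf.2⟩, add_sub_add_left_eq_sub,
      intervalIntegral.integral_interval_sub_left (hi _ _) (hi _ _), Real.dist_eq]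
    exact intervalIntegral.norm_integral_le_of_norm_le_const
      fun t _ => (hh.bounded _ _).trans (le_abs_self M)
  · filter_upwards [hsys.countable.ae_notMem volume, (countable_singleton 0).ae_notMem volume]
      with t ht ht0 htI
    have ht0' : 0 < t := lt_of_le_of_ne htI.1 fun e => ht0 e.symm
    have h1 := (hasDerivAt_integral_of_continuousAt_off_countable hsys.countable
      (hsys.continuousAt_comp (hφ.continuous y) y.2) (hi 0 t) ht).const_add y.1
    have h2 : HasDerivAt (φ y) (augmentedSystem P.T K h t (φ y t) y.2) t := by
      refine h1.congr_of_eventuallyEq ?_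
      filter_upwards [Ioo_mem_nhds ht0' (htI.2.trans_le htf.2)] with s hs
        using hφ.eq_add_integral y s (Ioo_subset_Icc_self hs)
    rw [hval t (Ico_subset_Icc_self htI)] at h2
    exact h2.fst
  · rw [hφ.eq_add_integral y tf htf, Prod.snd_add, hy, zero_add]
    have := (ContinuousLinearMap.snd ℝ (E n) ℝ).intervalIntegral_comp_comm (hi 0 tf)
    simp only [ContinuousLinearMap.coe_snd'] at this
    rw [← this]
    refine intervalIntegral.integral_congr fun s hs => ?_
    rw [uIcc_of_le htf.1] at hs
    simp only
    rw [hval s hs]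
    rfl

/-- A trajectory is a solution of the truncated system. -/
lemma isFlow_eq_of_isTrajectory (hT : 0 < P.T) (hL : 0 ≤ L)
    (hh : IsUniformlyC1 h Dh L M) (hφ : IsFlow (augmentedSystem P.T K h) b φ)
    (heq : ∀ t ∈ Icc 0 b, ∀ w, ‖w‖ < R → h t w = P.augField t w)
    {tf : ℝ} (htf : tf ∈ Icc 0 b) (htfK : tf ≤ ((K : ℝ) + 1) * P.T) {u : ℕ → E m} {q : ℝ → E n}
    (hq : P.IsTrajectory tf u q)
    (hRq : ∀ s ∈ Icc 0 tf, ‖q s‖ < R) (hRu : ∀ i : Fin (K + 1), ‖u i‖ < R) :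
    (∀ s ∈ Icc 0 tf, (φ ((q 0, 0), fun i => u i) s).1 = q s) ∧
      (φ ((q 0, 0), fun i => u i) tf).2 = P.cost tf u q := by
  have hsys := hh.parametricSystem (K := K) hT hL
  set x : Fin (K + 1) → E m := fun i => u i with hx
  set y : (E n × ℝ) × (Fin (K + 1) → E m) := ((q 0, 0), x) with hy
  have hqc : ContinuousOn q (Icc 0 tf) := by
    have := hq.1.continuousOn
    rwa [uIcc_of_le htf.1] at this
  set qe : ℝ → E n := fun s => q (projIcc 0 tf htf.1 s) with hqe
  have hqec : Continuous qe :=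
    (continuousOn_iff_continuous_domRestrict.1 hqc).comp (continuous_projIcc (h := htf.1))
  have hqe_eq : ∀ s ∈ Icc 0 tf, qe s = q s := fun s hs => by simp [hqe, projIcc_of_mem htf.1 hs]
  -- The field ignores the accumulated cost, so its coordinate may be set to zero here.
  let v : ℝ → E n × ℝ := fun s => augmentedSystem P.T K h s (qe s, 0) x
  have hvc : ∀ t ∉ samplingTimes P.T K, ContinuousAt v t :=
    hsys.continuousAt_comp (z := fun s => (qe s, 0)) (by fun_prop) x
  have hvi : ∀ a c, IntervalIntegrable v volume a c :=
    hsys.intervalIntegrable (z := fun s => (qe s, 0)) (by fun_prop) x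
  -- The end point is excluded: at `tf = (K + 1) T` the control switches to `u (K + 1)`, while the
  -- truncated system still holds `u K`.
  have hval : ∀ s ∈ Ico 0 tf, v s = P.augField s (q s, P.hold u s) := fun s hs => by
    have hs' := Ico_subset_Icc_self hs
    rw [hold_eq_of_lt hT u hs.1 (hs.2.trans_le htfK), ← hqe_eq s hs']
    refine heq s ⟨hs.1, hs'.2.trans htf.2⟩ _ (max_lt ?_ (hRu _))
    rw [hqe_eq s hs']
    exact hRq s hs'
  have hfst : ∀ t, (∫ s in (0 : ℝ)..t, v s).1 = ∫ s in (0 : ℝ)..t, (v s).1 := fun t =>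
    ((ContinuousLinearMap.fst ℝ (E n) ℝ).intervalIntegral_comp_comm (hvi 0 t)).symm
  have hsnd : ∀ t, (∫ s in (0 : ℝ)..t, v s).2 = ∫ s in (0 : ℝ)..t, (v s).2 := fun t =>
    ((ContinuousLinearMap.snd ℝ (E n) ℝ).intervalIntegral_comp_comm (hvi 0 t)).symm
  have hqint : ∀ t ∈ Icc 0 tf, q t = q 0 + ∫ s in (0 : ℝ)..t, (v s).1 := by
    refine hq.1.eq_add_integral hsys.countable htf.1 (M := M)
      (fun t => (norm_fst_le _).trans (hh.bounded _ _)) (fun t ht => (hvc t ht).fst) ?_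
    filter_upwards [hq.2] with t ht htI
    rw [hval t htI]
    exact ht htI
  let z : ℝ → E n × ℝ := fun t => (q 0, 0) + ∫ s in (0 : ℝ)..t, v s
  have hzc : Continuous z := continuous_const.add (intervalIntegral.continuous_primitive hvi 0)
  have hz1 : ∀ t ∈ Icc 0 tf, (z t).1 = q t := fun t ht => by
    rw [hqint t ht, ← hfst]; rfl
  -- Both curves solve the same Lipschitz equation from the same initial value, so the Grönwall
  -- bound between them is zero.
  have hφz : ∀ t ∈ Icc 0 tf, φ y t = z t := by
    have h1 := norm_sub_le_of_eq_add_integral (b := tf) (z₁ := (q 0, (0 : ℝ))) (z₂ := (q 0, (0 : ℝ)))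
      (w₁ := fun s => augmentedSystem P.T K h s (φ y s) x) (w₂ := v) hL le_rfl
      (hφ.continuous y).continuousOn hzc.continuousOn
      (hsys.intervalIntegrable (hφ.continuous y) x 0 tf) (hvi 0 tf)
      (fun t ht => hφ.eq_add_integral y t ⟨ht.1, ht.2.trans htf.2⟩) (fun t _ => rfl)
      (fun s hs => by
        have : v s = augmentedSystem P.T K h s (z s) x := by
          simp only [v, augmentedSystem]
          rw [hqe_eq s hs, hz1 s hs]
        rw [this]
        simpa using hsys.lipschitz s (φ y s) (z s) x x)
    intro t ht
    have := h1 t ht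
    rw [sub_self, norm_zero, mul_zero, add_zero, zero_mul] at this
    exact sub_eq_zero.1 (norm_le_zero_iff.1 this)
  refine ⟨fun s hs => by rw [hφz s hs, hz1 s hs], ?_⟩
  rw [hφz tf ⟨htf.1, le_rfl⟩]
  change 0 + (∫ s in (0 : ℝ)..tf, v s).2 = _
  rw [zero_add, hsnd]
  refine intervalIntegral.integral_congr_ae ?_
  filter_upwards [(countable_singleton tf).ae_notMem volume] with s hs hsI
  rw [uIoc_of_le htf.1] at hsI
  rw [hval s ⟨hsI.1.le, lt_of_le_of_ne hsI.2 hs⟩]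
  rfl

end Problem

end SampledData

/-! ### The adjoint vector and the extremality conditions. -/

namespace SampledData

open Filter Topology

/-- Fixed and free final times are treated alike, as a closed convex constraint of the multiplier
rule. In the free case all of `ℝ` is taken, so that the final time can be varied both ways;
nonnegativity is automatic near a positive `tf`. -/
lemma FinalTime.exists_convex_allowed (F : FinalTime) {tf : ℝ} (h : F.Allows tf) :
    ∃ Θ : Set ℝ, IsClosed Θ ∧ Convex ℝ Θ ∧ tf ∈ Θ ∧ (∀ t ∈ Θ, 0 ≤ t → F.Allows t) ∧
      (F = FinalTime.free → Θ = univ) := by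
  cases F with
  | fixed b =>
    exact ⟨{b}, isClosed_singleton, convex_singleton b, h.2, fun t ht h0 => ⟨h0, ht⟩, nofun⟩
  | free => exact ⟨univ, isClosed_univ, convex_univ, mem_univ _, fun t _ h0 => h0, fun _ => rfl⟩

/-- The adjoint vector attached to the final covector `ℓ` and to the resolvent `Λ`. -/
noncomputable def adjointVector {n : ℕ} (ℓ : E n × ℝ →L[ℝ] ℝ) (Λ : E n × ℝ →L[ℝ] E n × ℝ) : E n :=
  (InnerProductSpace.toDual ℝ (E n)).symm ((ℓ.comp Λ).comp (ContinuousLinearMap.inl ℝ _ _))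

lemma inner_adjointVector {n : ℕ} (ℓ : E n × ℝ →L[ℝ] ℝ) (Λ : E n × ℝ →L[ℝ] E n × ℝ) (v : E n) :
    inner ℝ (adjointVector ℓ Λ) v = ℓ (Λ (v, 0)) := by
  rw [adjointVector, InnerProductSpace.toDual_symm_apply]
  rfl

/-- `adjointVector` as a continuous linear map of the resolvent. -/
noncomputable def adjointVectorL {n : ℕ} (ℓ : E n × ℝ →L[ℝ] ℝ) :
    (E n × ℝ →L[ℝ] E n × ℝ) →L[ℝ] E n where
  toFun := adjointVector ℓ
  map_add' Λ Λ' := ext_inner_right ℝ fun v => by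
    simp [inner_add_left, inner_adjointVector]
  map_smul' r Λ := ext_inner_right ℝ fun v => by
    simp [inner_smul_left, inner_adjointVector]
  cont := (InnerProductSpace.toDual ℝ (E n)).symm.continuous.comp
    ((continuous_const.clm_comp continuous_id).clm_comp continuous_const)

section Resolvent

variable {n : ℕ} {Λ : ℝ → E n × ℝ →L[ℝ] E n × ℝ} {A : ℝ → E n × ℝ →L[ℝ] E n × ℝ} {C : Set ℝ}
  {L tf : ℝ}

/-- The cost component of the covector is constant. -/
lemma covector_adjointVector (hC : C.Countable) (hA : ∀ t ∉ C, ContinuousAt A t)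
    (hAL : ∀ t, ‖A t‖ ≤ L) (hA0 : ∀ t r, A t (0, r) = 0) (hΛc : Continuous Λ)
    (hΛ : ∀ t ∈ Icc 0 tf, Λ t = 1 + ∫ s in t..tf, (Λ s).comp (A s)) (ℓ : E n × ℝ →L[ℝ] ℝ)
    {t : ℝ} (ht : t ∈ Icc 0 tf) :
    ℓ.comp (Λ t) = Problem.covector (adjointVector ℓ (Λ t)) (ℓ (0, 1)) := by
  -- The linearized system annihilates the cost coordinate, so the resolvent fixes it; this is why
  -- `p⁰` is constant.
  have h1 : ∀ r : ℝ, Λ t (0, r) = (0, r) := fun r => by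
    rw [hΛ t ht, _root_.add_apply, ContinuousLinearMap.intervalIntegral_apply
      (resolvent_intervalIntegrable hC hA hAL hΛc _ _)]
    simp [hA0]
  ext z
  · simp [inner_adjointVector]
  · simp [h1]

lemma absolutelyContinuous_adjointVector (hC : C.Countable) (hA : ∀ t ∉ C, ContinuousAt A t)
    (hAL : ∀ t, ‖A t‖ ≤ L) (hΛc : Continuous Λ) (htf : 0 ≤ tf)
    (hΛ : ∀ t ∈ Icc 0 tf, Λ t = 1 + ∫ s in t..tf, (Λ s).comp (A s)) (ℓ : E n × ℝ →L[ℝ] ℝ) :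
    AbsolutelyContinuousOnInterval (fun t => adjointVector ℓ (Λ t)) 0 tf := by
  have hi := resolvent_intervalIntegrable hC hA hAL hΛc
  obtain ⟨B, hB⟩ := isCompact_Icc.exists_bound_of_continuousOn (s := Icc 0 tf) hΛc.continuousOn
  have hlip : LipschitzOnWith ⟨|B * L|, abs_nonneg _⟩ Λ (uIcc 0 tf) := by
    refine LipschitzOnWith.of_dist_le_mul fun s hs s' hs' => ?_
    rw [uIcc_of_le htf] at hs hs'
    rw [dist_eq_norm, hΛ s hs, hΛ s' hs', add_sub_add_left_eq_sub,
      intervalIntegral.integral_symm tf s, intervalIntegral.integral_symm tf s', neg_sub_neg,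
      intervalIntegral.integral_interval_sub_left (hi _ _) (hi _ _), dist_comm, Real.dist_eq]
    refine intervalIntegral.norm_integral_le_of_norm_le_const fun t ht => ?_
    have ht' := uIcc_subset_Icc hs hs' (uIoc_subset_uIcc ht)
    refine le_trans ?_ (le_abs_self (B * L))
    refine (ContinuousLinearMap.opNorm_comp_le _ _).trans ?_
    gcongr
    exacts [(norm_nonneg _).trans (hB t ht'), hB t ht', hAL _]
  exact ((adjointVectorL ℓ).lipschitz.comp_lipschitzOnWith hlip).absolutelyContinuousOnInterval

end Resolvent

namespace Problem

variable {n m j : ℕ} {P : Problem n m j}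

/-- The derivative of the final covector in the direction of a variation `v` of the `k`-th value of
the control is the pairing of `v` with the averaged gradient of the Hamiltonian. -/
lemma integral_gradControlH_eq {K : ℕ} (hT : 0 < P.T)
    (hf : IsC1InStateControl P.f) (hf₀ : IsC1InStateControl P.f₀)
    {Λ : ℝ → E n × ℝ →L[ℝ] E n × ℝ} (hΛc : Continuous Λ) {tf : ℝ} (htf : 0 ≤ tf)
    (hKle : tf ≤ ((K : ℝ) + 1) * P.T) {D : ℝ → E n × E m →L[ℝ] E n × ℝ} {L : ℝ}
    (hDc : ∀ t ∉ samplingTimes P.T K, ContinuousAt D t) (hDL : ∀ t, ‖D t‖ ≤ L)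
    {u : ℕ → E m} {q p : ℝ → E n} {c : ℝ}
    (hDval : ∀ s ∈ Ico 0 tf, D s = P.augFieldDeriv s (q s, P.hold u s))
    (ℓ : E n × ℝ →L[ℝ] ℝ) (hcov : ∀ t ∈ Icc 0 tf, ℓ.comp (Λ t) = covector (p t) c)
    {k : ℕ} (hkK : k ≤ K) (hk : (k : ℝ) * P.T < tf) (v : E m) :
    inner ℝ (∫ s in ((k : ℝ) * P.T)..(min (((k : ℝ) + 1) * P.T) tf),
      P.gradControlH s (q s) (p s) c (u k)) v =
      ℓ ((∫ s in (0 : ℝ)..tf, (Λ s).comp (controlDeriv P.T K (D s) s))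
        (Pi.single ⟨k, Nat.lt_succ_of_le hkK⟩ v)) := by
  have hBc : ∀ t ∉ samplingTimes P.T K,
      ContinuousAt (fun s => controlDeriv P.T K (D s) s) t := fun t ht =>
    continuousAt_controlDeriv hT (hDc t ht) ht
  set B : ℝ → (Fin (K + 1) → E m) →L[ℝ] E n × ℝ := fun s => controlDeriv P.T K (D s) s with hB
  set κ : Fin (K + 1) := ⟨k, Nat.lt_succ_of_le hkK⟩ with hκ
  set s₁ := (k : ℝ) * P.T with hs₁
  set s₂ := min (((k : ℝ) + 1) * P.T) tf with hs₂
  have hs₁0 : 0 ≤ s₁ := by positivity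
  have hs₁₂ : s₁ ≤ s₂ := le_min (by rw [hs₁]; gcongr; linarith) hk.le
  have hs₂tf : s₂ ≤ tf := min_le_right _ _
  set δx : Fin (K + 1) → E m := Pi.single κ v with hδx
  set Bint := ∫ s in (0 : ℝ)..tf, (Λ s).comp (B s) with hBint
  obtain ⟨N, hN⟩ := isCompact_Icc.exists_bound_of_continuousOn (s := Icc 0 tf) hΛc.continuousOn
  have hN0 : 0 ≤ N := (norm_nonneg _).trans (hN 0 ⟨le_rfl, htf⟩)
  have hsub : ∀ a ∈ Icc 0 tf, ∀ c ∈ Icc 0 tf, uIcc a c ⊆ Icc 0 tf := fun a ha c hc =>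
    uIcc_subset_Icc ha hc
  have hΛBi : ∀ a ∈ Icc 0 tf, ∀ c ∈ Icc 0 tf,
      IntervalIntegrable (fun s => (Λ s).comp (B s)) volume a c := fun a ha c hc => by
    refine intervalIntegrable_of_continuousAt_off_countable (countable_samplingTimes P.T K) (M := N * L)
      (fun t ht => hΛc.continuousAt.clm_comp (hBc t ht)) fun t ht => ?_
    refine (ContinuousLinearMap.opNorm_comp_le _ _).trans ?_
    gcongr
    exacts [hN t (hsub a ha c hc ht), (norm_controlDeriv_le _ _ _ _).trans (hDL t)]
  set ω : ℝ → ℝ := fun s => ℓ (Λ s (B s δx)) with hω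
  set ev : ((Fin (K + 1) → E m) →L[ℝ] E n × ℝ) →L[ℝ] ℝ :=
    ℓ.comp (ContinuousLinearMap.apply ℝ (E n × ℝ) δx) with hev
  have hωi : ∀ a ∈ Icc 0 tf, ∀ c ∈ Icc 0 tf, IntervalIntegrable ω volume a c :=
    fun a ha c hc => ⟨ev.integrable_comp (hΛBi a ha c hc).1,
      ev.integrable_comp (hΛBi a ha c hc).2⟩
  have m0 : (0 : ℝ) ∈ Icc 0 tf := ⟨le_rfl, htf⟩
  have mtf : tf ∈ Icc 0 tf := ⟨htf, le_rfl⟩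
  have m1 : s₁ ∈ Icc 0 tf := ⟨hs₁0, hk.le⟩
  have m2 : s₂ ∈ Icc 0 tf := ⟨hs₁0.trans hs₁₂, hs₂tf⟩
  have hℓω : ℓ (Bint δx) = ∫ s in (0 : ℝ)..tf, ω s :=
    (ev.intervalIntegral_comp_comm (hΛBi 0 m0 tf mtf)).symm
  -- The variation changes only the `k`-th control value, so it acts only during the `k`-th sampling
  -- interval.
  have hω0 : ∀ s, holdIndex P.T K s ≠ κ → ω s = 0 := fun s hs => by
    have h4 : ((0 : E n), (0 : E m)) = 0 := rfl
    simp [hω, hB, hδx, hs, h4]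
  have hI1 : ∫ s in (0 : ℝ)..s₁, ω s = 0 := by
    refine intervalIntegral.integral_zero_ae ?_
    filter_upwards [(countable_singleton s₁).ae_notMem volume] with s hs hsI
    rw [uIoc_of_le hs₁0] at hsI
    refine hω0 s fun e => ?_
    have h1 : s < s₁ := lt_of_le_of_ne hsI.2 hs
    have h2 : (holdIndex P.T K s : ℕ) = k := by rw [e]
    have h3 : k ≤ ⌊s / P.T⌋₊ := by rw [← h2]; exact min_le_left _ _
    have h4 := (le_div_iff₀ hT).1
      ((Nat.le_floor_iff (div_nonneg hsI.1.le hT.le)).1 h3)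
    linarith
  have hI3 : ∫ s in s₂..tf, ω s = 0 := by
    refine intervalIntegral.integral_zero_ae ?_
    filter_upwards [(countable_singleton tf).ae_notMem volume] with s hs hsI
    rw [uIoc_of_le hs₂tf] at hsI
    have hstf : s < tf := lt_of_le_of_ne hsI.2 hs
    refine hω0 s fun e => ?_
    have h1 : ((k : ℝ) + 1) * P.T < s := by
      rcases min_lt_iff.1 hsI.1 with h | h
      · exact h
      · exact absurd h hstf.not_gt
    have h2 : (holdIndex P.T K s : ℕ) = k := by rw [e]
    have h3 : k + 1 ≤ ⌊s / P.T⌋₊ := Nat.le_floor (by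
      rw [le_div_iff₀ hT]; push_cast; exact h1.le)
    -- An index equal to `k` after time `(k + 1) T` can only come from the unbounded last interval,
    -- and `tf ≤ (K + 1) T` rules this out.
    have h4 : k = K := by
      simp only [holdIndex] at h2
      omega
    rw [h4] at h1
    linarith
  have hsplit : ∫ s in (0 : ℝ)..tf, ω s = ∫ s in s₁..s₂, ω s := by
    rw [← intervalIntegral.integral_add_adjacent_intervals (hωi 0 m0 s₁ m1) (hωi s₁ m1 tf mtf),
      ← intervalIntegral.integral_add_adjacent_intervals (hωi s₁ m1 s₂ m2) (hωi s₂ m2 tf mtf),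
      hI1, hI3]
    ring
  have hIco : ∀ s ∈ Ioc s₁ s₂, s ≠ s₂ → s ∈ Ico 0 tf ∧ (holdIndex P.T K s : ℕ) = k := by
    intro s hs hne
    have h1 : s < s₂ := lt_of_le_of_ne hs.2 hne
    exact ⟨⟨hs₁0.trans hs.1.le, h1.trans_le hs₂tf⟩,
      holdIndex_eq_of_mem_Ico hT hkK ⟨hs.1.le, h1.trans_le (min_le_left _ _)⟩⟩
  -- the integrand of the maximization condition
  let γ : ℝ → E m := fun s => (InnerProductSpace.toDual ℝ (E m)).symm
    ((ℓ.comp (Λ s)).comp ((D s).comp (ContinuousLinearMap.inr ℝ _ _)))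
  have hγc : ∀ t ∉ samplingTimes P.T K, ContinuousAt γ t := fun t ht => by
    have h1 : ContinuousAt (fun s => (ℓ.comp (Λ s)).comp
        ((D s).comp (ContinuousLinearMap.inr ℝ (E n) (E m)))) t :=
      (continuousAt_const.clm_comp hΛc.continuousAt).clm_comp
        ((hDc t ht).clm_comp continuousAt_const)
    exact (InnerProductSpace.toDual ℝ (E m)).symm.continuous.continuousAt.comp h1
  have hγi : IntervalIntegrable γ volume s₁ s₂ := by
    refine intervalIntegrable_of_continuousAt_off_countable (countable_samplingTimes P.T K)
      (M := ‖ℓ‖ * N * (L * ‖ContinuousLinearMap.inr ℝ (E n) (E m)‖)) hγc fun t ht => ?_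
    change ‖(InnerProductSpace.toDual ℝ (E m)).symm _‖ ≤ _
    rw [LinearIsometryEquiv.norm_map]
    refine (ContinuousLinearMap.opNorm_comp_le _ _).trans ?_
    gcongr
    · refine (ContinuousLinearMap.opNorm_comp_le _ _).trans ?_
      gcongr
      exact hN t (hsub s₁ m1 s₂ m2 ht)
    · refine (ContinuousLinearMap.opNorm_comp_le _ _).trans ?_
      gcongr
      exact hDL _
  have hγeq : ∫ s in s₁..s₂, P.gradControlH s (q s) (p s) c (u k) = ∫ s in s₁..s₂, γ s := by
    refine intervalIntegral.integral_congr_ae ?_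
    filter_upwards [(countable_singleton s₂).ae_notMem volume] with s hs hsI
    rw [uIoc_of_le hs₁₂] at hsI
    obtain ⟨h1, h2⟩ := hIco s hsI hs
    rw [gradControlH_eq hf hf₀]
    simp only [γ]
    rw [hcov s (Ico_subset_Icc_self h1), hDval s h1,
      hold_eq_of_lt hT u h1.1 (h1.2.trans_le hKle), h2]
  have hγω : inner ℝ (∫ s in s₁..s₂, γ s) v = ∫ s in s₁..s₂, ω s := by
    have h1 := ((innerSL ℝ v).intervalIntegral_comp_comm hγi).symm
    rw [real_inner_comm]
    refine h1.trans ?_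
    refine intervalIntegral.integral_congr_ae ?_
    filter_upwards [(countable_singleton s₂).ae_notMem volume] with s hs hsI
    rw [uIoc_of_le hs₁₂] at hsI
    obtain ⟨-, h2⟩ := hIco s hsI hs
    have h3 : holdIndex P.T K s = κ := Fin.ext h2
    rw [innerSL_apply_apply, real_inner_comm, InnerProductSpace.toDual_symm_apply]
    simp [hω, hB, h3, hδx]
  rw [hγeq, hγω, ← hsplit, ← hℓω]

set_option maxHeartbeats 1000000 in
/-- The maximum principle for a problem whose terminal constraint is strengthened to `g ∈ S`, with
`g` submersive at the end points of the optimal trajectory. -/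
theorem exists_extremal_of_surjective {Y : Type*} [NormedAddCommGroup Y] [InnerProductSpace ℝ Y]
    [FiniteDimensional ℝ Y] (hT : 0 < P.T)
    (hf : IsC1InStateControl P.f) (hf₀ : IsC1InStateControl P.f₀)
    (hΩ_closed : IsClosed P.Ω) (hΩ_convex : Convex ℝ P.Ω)
    {g : E n × E n → Y} (hg : ContDiff ℝ 1 g) {S : Set Y} (hS_closed : IsClosed S)
    (hS_convex : Convex ℝ S) (hgS : ∀ z, g z ∈ S → P.g z ∈ P.S)
    {tf : ℝ} (htf : 0 < tf) {u : ℕ → E m} {q : ℝ → E n} (hgq : g (q 0, q tf) ∈ S)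
    (hsurj : Function.Surjective (fderiv ℝ g (q 0, q tf))) (hopt : P.IsOptimal tf u q) :
    ∃ (p : ℝ → E n) (p₀ : ℝ) (ψ : Y),
      AbsolutelyContinuousOnInterval p 0 tf ∧ p₀ ≤ 0 ∧ (p₀ ≠ 0 ∨ ∃ t ∈ Icc 0 tf, p t ≠ 0) ∧
      P.ExtremalEquations tf u q p p₀ ∧ P.MaximizationCondition tf u q p p₀ ∧
      (∀ s ∈ S, inner ℝ (-ψ) (s - g (q 0, q tf)) ≤ 0) ∧
      (∀ v, inner ℝ (p 0) v = -inner ℝ ψ (fderiv ℝ g (q 0, q tf) (v, 0))) ∧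
      (∀ v, inner ℝ (p tf) v = inner ℝ ψ (fderiv ℝ g (q 0, q tf) (0, v))) ∧
      (P.finalTime = FinalTime.free → P.H tf (q tf) (p tf) p₀ (u (P.lastIndex tf)) = 0) := by
  obtain ⟨⟨hallow, huΩ, hq, -⟩, hmin⟩ := hopt
  set K := P.lastIndex tf with hK
  have hKlt : (K : ℝ) * P.T < tf := lastIndex_mul_lt hT htf
  have hKle : tf ≤ ((K : ℝ) + 1) * P.T := le_lastIndex_add_one_mul hT htf
  -- The flow is built beyond `tf`, so that the final time is an interior point of its domain.
  set b := tf + 1 with hb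
  have hb0 : 0 ≤ b := by positivity
  have htfb : tf ∈ Ioo 0 b := ⟨htf, by linarith⟩
  have htfb' := Ioo_subset_Icc_self htfb
  have hqc : ContinuousOn q (Icc 0 tf) := by
    have := hq.1.continuousOn
    rwa [uIcc_of_le htf.le] at this
  obtain ⟨Rq, hRq⟩ := isCompact_Icc.exists_bound_of_continuousOn hqc
  have hRq0 : 0 ≤ Rq := (norm_nonneg _).trans (hRq 0 ⟨le_rfl, htf.le⟩)
  set x₀ : Fin (K + 1) → E m := fun i => u i with hx₀
  -- The reference state and control values stay below `R - 1` in norm, so perturbations smaller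
  -- than `1` remain where the truncated and original fields agree.
  set R := Rq + ‖x₀‖ + 2 with hR
  have hRpos : 0 < R := by positivity
  -- the truncated system and its flow
  obtain ⟨h, Dh, L, M, hL, hh, hhR⟩ := exists_isUniformlyC1_eqOn_ball
    (continuous_augField hf hf₀) (continuous_augFieldDeriv hf hf₀)
    (hasFDerivAt_augField hf hf₀) hb0 hRpos
  have heq : ∀ t ∈ Icc 0 b, ∀ w, ‖w‖ < R → h t w = P.augField t w := fun t ht w hw =>
    (hhR t ht w hw).1
  have hsys := hh.parametricSystem (K := K) hT hL
  obtain ⟨φ, hφ⟩ := hsys.exists_isFlow hL hb0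
  set y₀ : (E n × ℝ) × (Fin (K + 1) → E m) := ((q 0, 0), x₀) with hy₀
  have hx₀R : ∀ i, ‖x₀ i‖ < R - 1 := fun i => by
    have := norm_le_pi_norm x₀ i
    linarith
  obtain ⟨hφq, hφcost⟩ := isFlow_eq_of_isTrajectory hT hL hh hφ heq htfb' hKle hq
    (fun s hs => by linarith [hRq s hs, norm_nonneg x₀]) (fun i => by
      have : ‖u i‖ < R - 1 := hx₀R i
      linarith)
  change ∀ s ∈ Icc 0 tf, (φ y₀ s).1 = q s at hφq
  change (φ y₀ tf).2 = _ at hφcost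
  -- the linearized system and its adjoint
  set D : ℝ → E n × E m →L[ℝ] E n × ℝ := fun s => Dh s ((φ y₀ s).1, x₀ (holdIndex P.T K s)) with hD
  set A : ℝ → E n × ℝ →L[ℝ] E n × ℝ := fun s => stateDeriv (D s) with hA
  set B : ℝ → (Fin (K + 1) → E m) →L[ℝ] E n × ℝ := fun s => controlDeriv P.T K (D s) s with hB
  have hφ1c : Continuous fun s => (φ y₀ s).1 := (hφ.continuous y₀).fst
  have hDc : ∀ t ∉ samplingTimes P.T K, ContinuousAt D t := fun t ht =>
    hh.continuousAt_deriv hT hφ1c x₀ ht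
  have hAc : ∀ t ∉ samplingTimes P.T K, ContinuousAt A t := fun t ht =>
    (hDc t ht).clm_comp continuousAt_const
  have hBc : ∀ t ∉ samplingTimes P.T K, ContinuousAt B t := fun t ht =>
    continuousAt_controlDeriv hT (hDc t ht) ht
  have hAL : ∀ t, ‖A t‖ ≤ L := fun t => (norm_stateDeriv_le _).trans (hh.bounded_deriv _ _)
  have hBL : ∀ t, ‖B t‖ ≤ L := fun t => (norm_controlDeriv_le _ _ _ _).trans (hh.bounded_deriv _ _)
  have hDval : ∀ s ∈ Ico 0 tf, D s = P.augFieldDeriv s (q s, P.hold u s) := fun s hs => by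
    have hs' := Ico_subset_Icc_self hs
    rw [hold_eq_of_lt hT u hs.1 (hs.2.trans_le hKle), ← hφq s hs']
    refine (hhR s ⟨hs.1, hs'.2.trans htfb'.2⟩ _ (max_lt ?_ ?_)).2
    · change ‖(φ y₀ s).1‖ < R
      rw [hφq s hs']; linarith [hRq s hs', norm_nonneg x₀]
    · have := hx₀R (holdIndex P.T K s)
      change ‖x₀ (holdIndex P.T K s)‖ < R
      linarith
  obtain ⟨Λ, hΛc, hΛ⟩ := exists_adjoint_resolvent hsys.countable hAc hAL htf.le
  have htfC : tf ∉ samplingTimes P.T K := by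
    rintro ⟨k, hk, rfl⟩
    have : (k : ℝ) ≤ K := by exact_mod_cast hk
    exact absurd hKlt (not_lt.2 (mul_le_mul_of_nonneg_right this hT.le))
  have hstrict := hφ.hasStrictFDerivAt hsys hL htfb htfC hAc hAL hBc hBL
    (fun ε hε => by
      obtain ⟨δ, hδ, H⟩ := hh.strict_augmentedSystem (T := P.T) (z₀ := φ y₀) (x₀ := x₀) hε
      exact ⟨δ, hδ, fun t _ => H t⟩) hΛc hΛ
  set Bint := ∫ s in (0 : ℝ)..tf, (Λ s).comp (B s) with hBint
  set Φ' := ((Λ 0).coprod Bint).coprod (ContinuousLinearMap.toSpanSingleton ℝ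
    (augmentedSystem P.T K h tf (φ y₀ tf) y₀.2)) with hΦ'
  -- the finite dimensional problem
  obtain ⟨Θ, hΘc, hΘconv, hΘtf, hΘallow, hΘfree⟩ := P.finalTime.exists_convex_allowed hallow
  -- The initial accumulated cost is a coordinate of the flow; freezing it at `0` makes the last
  -- component of the final value equal to the cost.
  let Cset : Set (((E n × ℝ) × (Fin (K + 1) → E m)) × ℝ) :=
    {w | w.1.1.2 = 0 ∧ (∀ i, w.1.2 i ∈ P.Ω) ∧ w.2 ∈ Θ}
  have hCc : IsClosed Cset := by
    have h1 : Cset = {w | w.1.1.2 = 0} ∩ ((⋂ i, {w | w.1.2 i ∈ P.Ω}) ∩ Prod.snd ⁻¹' Θ) := by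
      ext w; simp [Cset]
    rw [h1]
    exact (isClosed_eq (by fun_prop) continuous_const).inter
      ((isClosed_iInter fun i => hΩ_closed.preimage (by fun_prop)).inter
        (hΘc.preimage continuous_snd))
  have hCconv : Convex ℝ Cset := by
    rintro w ⟨h1, h2, h3⟩ w' ⟨h1', h2', h3'⟩ α β hα hβ hαβ
    refine ⟨?_, fun i => ?_, ?_⟩
    · simp [h1, h1']
    · exact hΩ_convex (h2 i) (h2' i) hα hβ hαβ
    · exact hΘconv h3 h3' hα hβ hαβ
  set g' := fderiv ℝ g (q 0, q tf) with hg'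
  have hw₀ : ((y₀, tf) : ((E n × ℝ) × (Fin (K + 1) → E m)) × ℝ) ∈ Cset :=
    ⟨rfl, fun i => huΩ i, hΘtf⟩
  have hφtf : (φ y₀ tf).1 = q tf := hφq tf ⟨htf.le, le_rfl⟩
  have hJ : HasStrictFDerivAt (fun w : ((E n × ℝ) × (Fin (K + 1) → E m)) × ℝ => (φ w.1 w.2).2)
      ((ContinuousLinearMap.snd ℝ (E n) ℝ).comp Φ') (y₀, tf) := hstrict.snd
  have hgstrict : HasStrictFDerivAt g g' (q 0, q tf) :=
    hg.contDiffAt.hasStrictFDerivAt (by simp)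
  have hG : HasStrictFDerivAt
      (fun w : ((E n × ℝ) × (Fin (K + 1) → E m)) × ℝ => g (w.1.1.1, (φ w.1 w.2).1))
      (g'.comp ((((ContinuousLinearMap.fst ℝ (E n) ℝ).comp
        ((ContinuousLinearMap.fst ℝ _ _).comp (ContinuousLinearMap.fst ℝ _ _)))).prod
        ((ContinuousLinearMap.fst ℝ (E n) ℝ).comp Φ'))) (y₀, tf) := by
    have h1 : HasStrictFDerivAt
        (fun w : ((E n × ℝ) × (Fin (K + 1) → E m)) × ℝ => (w.1.1.1, (φ w.1 w.2).1))
        ((((ContinuousLinearMap.fst ℝ (E n) ℝ).comp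
        ((ContinuousLinearMap.fst ℝ _ _).comp (ContinuousLinearMap.fst ℝ _ _)))).prod
        ((ContinuousLinearMap.fst ℝ (E n) ℝ).comp Φ')) (y₀, tf) :=
      (((ContinuousLinearMap.fst ℝ (E n) ℝ).comp ((ContinuousLinearMap.fst ℝ _ _).comp
        (ContinuousLinearMap.fst ℝ _ _))).hasStrictFDerivAt (x := (y₀, tf))).prodMk hstrict.fst
    refine HasStrictFDerivAt.comp (y₀, tf) (g := g) ?_ h1
    change HasStrictFDerivAt g g' (q 0, (φ y₀ tf).1)
    rwa [hφtf]
  -- Near `(y₀, tf)` the truncated flow yields genuine admissible trajectories with the right cost,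
  -- so optimality passes to the finite-dimensional problem.
  have hlocal : ∀ᶠ w : ((E n × ℝ) × (Fin (K + 1) → E m)) × ℝ in 𝓝 (y₀, tf), w ∈ Cset →
      g (w.1.1.1, (φ w.1 w.2).1) ∈ S → (φ y₀ tf).2 ≤ (φ w.1 w.2).2 := by
    set K₁ := (1 + b * L) * Real.exp (L * b)
    have hK₁ : 0 ≤ K₁ := by positivity
    -- Competing final times may exceed `tf`, where the bound on `q` says nothing.
    have hnear : ∀ᶠ s in 𝓝 tf, ‖(φ y₀ s).1‖ < R - 1 := by
      refine hφ1c.norm.continuousAt.eventually_lt continuousAt_const ?_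
      rw [hφtf]
      linarith [hRq tf ⟨htf.le, le_rfl⟩, norm_nonneg x₀]
    obtain ⟨η, hη, hηball⟩ := Metric.eventually_nhds_iff_ball.1 hnear
    have e1 : ∀ᶠ w : ((E n × ℝ) × (Fin (K + 1) → E m)) × ℝ in 𝓝 (y₀, tf),
        K₁ * ‖w.1 - y₀‖ < 1 ∧ ‖w.1 - y₀‖ < 1 := by
      have c1 : Continuous fun w : ((E n × ℝ) × (Fin (K + 1) → E m)) × ℝ => K₁ * ‖w.1 - y₀‖ := by
        fun_prop
      have c2 : Continuous fun w : ((E n × ℝ) × (Fin (K + 1) → E m)) × ℝ => ‖w.1 - y₀‖ := by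
        fun_prop
      exact (c1.continuousAt.eventually_lt continuousAt_const (by simp)).and
        (c2.continuousAt.eventually_lt continuousAt_const (by simp))
    have e2 : ∀ᶠ w : ((E n × ℝ) × (Fin (K + 1) → E m)) × ℝ in 𝓝 (y₀, tf),
        w.2 ∈ Ioo 0 b ∩ Metric.ball tf η :=
      continuousAt_snd (inter_mem (Ioo_mem_nhds htfb.1 htfb.2) (Metric.ball_mem_nhds tf hη))
    filter_upwards [e1, e2]
    rintro ⟨y, t⟩ ⟨h1, h1'⟩ ⟨h2, h3⟩ ⟨hy0, hyΩ, hΘ⟩ hgy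
    simp only at h1 h1' h2 h3 hy0 hyΩ hΘ hgy ⊢
    have ht := Ioo_subset_Icc_self h2
    rw [Metric.mem_ball, Real.dist_eq, abs_lt] at h3
    have hyR : ∀ s ∈ Icc 0 t, ‖(φ y s).1‖ < R := fun s hs => by
      have h4 : ‖(φ y₀ s).1‖ < R - 1 := by
        rcases le_or_gt s tf with hs' | hs'
        · rw [hφq s ⟨hs.1, hs'⟩]
          linarith [hRq s ⟨hs.1, hs'⟩, norm_nonneg x₀]
        · refine hηball s ?_
          rw [Metric.mem_ball, Real.dist_eq, abs_lt]
          constructor <;> linarith [hs.2]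
      have h5 := hφ.norm_flow_sub_le hsys hL y y₀ (t := s) ⟨hs.1, hs.2.trans ht.2⟩
      have h6 : ‖(φ y s).1 - (φ y₀ s).1‖ ≤ ‖φ y s - φ y₀ s‖ := norm_fst_le (φ y s - φ y₀ s)
      have h7 := norm_le_norm_add_norm_sub' (φ y s).1 (φ y₀ s).1
      linarith
    have hyu : ∀ i, ‖y.2 i‖ < R := fun i => by
      have h4 : ‖y.2 i - x₀ i‖ ≤ ‖y - y₀‖ :=
        (norm_le_pi_norm (y.2 - x₀) i).trans (norm_snd_le (y - y₀))
      have h7 := norm_le_norm_add_norm_sub' (y.2 i) (x₀ i)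
      linarith [hx₀R i]
    obtain ⟨htraj, hcost⟩ := isTrajectory_and_cost_eq_of_isFlow hT hL hh hφ heq hy0 ht hyR hyu
    have hφ0 : φ y 0 = y.1 := by
      simpa using hφ.eq_add_integral y 0 ⟨le_rfl, hb0⟩
    rw [hφcost, ← hcost]
    refine hmin t _ _ ⟨hΘallow t hΘ ht.1, fun k => hyΩ _, htraj, hgS _ ?_⟩
    change g ((φ y 0).1, (φ y t).1) ∈ S
    rw [hφ0]
    exact hgy
  obtain ⟨c, ψ, hc, hne, hψS, hvar⟩ := exists_fritzJohn_multipliers hCc hCconv hS_closed hS_convex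
    hJ hG hw₀ (by change g (q 0, (φ y₀ tf).1) ∈ S; rwa [hφtf]) hlocal
  change ∀ s ∈ S, inner ℝ (-ψ) (s - g (q 0, (φ y₀ tf).1)) ≤ 0 at hψS
  rw [hφtf] at hψS
  -- the adjoint vector
  set ℓ : E n × ℝ →L[ℝ] ℝ :=
    ((innerSL ℝ ψ).comp (g'.comp (ContinuousLinearMap.inr ℝ _ _))).coprod
      (c • ContinuousLinearMap.id ℝ ℝ) with hℓ
  have hℓ_apply : ∀ z, ℓ z = inner ℝ ψ (g' (0, z.1)) + c * z.2 := fun z => by simp [hℓ]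
  have hℓ1 : ℓ (0, 1) = c := by
    rw [hℓ_apply]
    have : ((0 : E n), (0 : E n)) = 0 := rfl
    simp [this]
  set p : ℝ → E n := fun t => adjointVector ℓ (Λ t) with hp
  have hcov : ∀ t ∈ Icc 0 tf, ℓ.comp (Λ t) = covector (p t) c := fun t ht => by
    have := covector_adjointVector hsys.countable hAc hAL (fun t r => (D t).map_zero) hΛc hΛ ℓ ht
    rwa [hℓ1] at this
  have hΛtf : Λ tf = 1 := by simpa using hΛ tf ⟨htf.le, le_rfl⟩
  -- the variational inequality
  have hvar' : ∀ w ∈ Cset, inner ℝ ψ (g' ((w - (y₀, tf)).1.1.1, 0)) + ℓ (Φ' (w - (y₀, tf))) ≤ 0 := by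
    intro w hw
    have h1 := hvar w hw
    rw [hℓ_apply, ← add_assoc, ← inner_add_right, ← map_add]
    simp only [Prod.mk_add_mk, add_zero, zero_add]
    rw [add_comm]
    exact h1
  -- The initial state is unconstrained in `Cset`, so the inequality holds for `v` and `-v` and is
  -- an equality.
  have hp0 : ∀ v, inner ℝ (p 0) v = -inner ℝ ψ (g' (v, 0)) := by
    have key : ∀ v, inner ℝ ψ (g' (v, 0)) + inner ℝ (p 0) v ≤ 0 := fun v => by
      have h1 := hvar' (((q 0 + v, 0), x₀), tf) ⟨rfl, fun i => huΩ i, hΘtf⟩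
      have h2 : ((((q 0 + v, 0), x₀), tf) - (y₀, tf) : ((E n × ℝ) × (Fin (K + 1) → E m)) × ℝ) =
          (((v, 0), 0), 0) := by simp [hy₀]
      rw [h2] at h1
      rw [hp, inner_adjointVector]
      simpa [hΦ'] using h1
    intro v
    have h1 := key v
    have h2 := key (-v)
    have h3 : ((-v, 0) : E n × E n) = -(v, 0) := by simp
    rw [h3, map_neg, inner_neg_right, inner_neg_right] at h2
    linarith
  have hptf : ∀ v, inner ℝ (p tf) v = inner ℝ ψ (g' (0, v)) := fun v => by
    rw [hp, inner_adjointVector, hΛtf, one_apply_eq_self, hℓ_apply]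
    simp
  refine ⟨p, c, ψ, absolutelyContinuous_adjointVector hsys.countable hAc hAL hΛc htf.le hΛ ℓ, hc,
    ?_, ?_, ?_, hψS, hp0, hptf, fun hfree => ?_⟩
  · -- nontriviality
    by_contra! hcon
    obtain ⟨hc0, hpz⟩ := hcon
    have hψ : ψ ≠ 0 := hne.resolve_left (not_not.2 hc0)
    -- If `p` vanishes at both ends, then `ψ` is orthogonal to the range of `g'`, hence to itself.
    obtain ⟨⟨v₁, v₂⟩, hv⟩ := hsurj ψ
    have h1 := hp0 v₁
    have h2 := hptf v₂
    rw [hpz 0 ⟨le_rfl, htf.le⟩, inner_zero_left] at h1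
    rw [hpz tf ⟨htf.le, le_rfl⟩, inner_zero_left] at h2
    have h3 : inner ℝ ψ (g' (v₁, v₂)) = 0 := by
      have : ((v₁, v₂) : E n × E n) = (v₁, 0) + (0, v₂) := by simp
      rw [this, map_add, inner_add_right]
      linarith
    rw [hv] at h3
    exact hψ (inner_self_eq_zero.1 h3)
  · -- extremal equations
    filter_upwards [hq.2, hsys.countable.ae_notMem volume,
      (countable_singleton 0).ae_notMem volume] with t h1 h2 h3 ht
    have ht0 : t ∈ Ioo 0 tf := ⟨lt_of_le_of_ne ht.1 fun e => h3 e.symm, ht.2⟩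
    refine ⟨by rw [gradAdjointH_eq]; exact h1 ht, ?_⟩
    have h4 := hasDerivAt_adjoint_resolvent hsys.countable hAc hAL hΛc hΛ ht0 h2
    have h5 := (adjointVectorL ℓ).hasFDerivAt.comp_hasDerivAt t h4
    refine HasDerivAt.congr_deriv (f := p) h5 ?_
    rw [map_neg, gradStateH_eq hf hf₀, ← hDval t ht,
      ← hcov t (Ico_subset_Icc_self ht)]
    congr 1
  · -- maximization condition
    intro k hk y hy
    have hkK : k ≤ K := by
      have h1 : (k : ℝ) * P.T < ((K : ℝ) + 1) * P.T := hk.trans_le hKle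
      have h2 : (k : ℝ) < K + 1 := lt_of_mul_lt_mul_right h1 hT.le
      exact Nat.lt_succ_iff.1 (by exact_mod_cast h2)
    set κ : Fin (K + 1) := ⟨k, Nat.lt_succ_of_le hkK⟩ with hκ
    have hineq : ℓ (Bint (Pi.single κ (y - u k))) ≤ 0 := by
      have h1 := hvar' (((q 0, 0), Function.update x₀ κ y), tf) ⟨rfl, fun i => by
        rcases eq_or_ne i κ with rfl | hi
        · simpa using hy
        · simpa [hi] using huΩ i, hΘtf⟩
      have h2 : ((((q 0, 0), Function.update x₀ κ y), tf) - (y₀, tf) :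
          ((E n × ℝ) × (Fin (K + 1) → E m)) × ℝ) = (((0, 0), Pi.single κ (y - u k)), 0) := by
        have : Function.update x₀ κ y - x₀ = Pi.single κ (y - u k) := by
          ext1 i
          rcases eq_or_ne i κ with rfl | hi
          · simp [hx₀, hκ]
          · simp [hi]
        simp only [hy₀, Prod.mk_sub_mk, sub_self, this]
        rfl
      rw [h2] at h1
      have h3 : ((0 : E n), (0 : E n)) = 0 := rfl
      have h4 : ((0 : E n), (0 : ℝ)) = 0 := rfl
      simpa [hΦ', h3, h4] using h1
    rw [integral_gradControlH_eq hT hf hf₀ hΛc htf.le hKle hDc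
      (fun t => hh.bounded_deriv _ _) hDval ℓ hcov hkK hk]
    exact hineq
  · -- the final time
    have key : ∀ r : ℝ, r * P.H tf (q tf) (p tf) c (u K) ≤ 0 := fun r => by
      have h1 := hvar' (y₀, tf + r) ⟨rfl, fun i => huΩ i, by rw [hΘfree hfree]; trivial⟩
      have h2 : ((y₀, tf + r) - (y₀, tf) : ((E n × ℝ) × (Fin (K + 1) → E m)) × ℝ) = (0, r) := by
        simp
      have h3 : augmentedSystem P.T K h tf (φ y₀ tf) y₀.2 = P.augField tf (q tf, u K) := by
        have h4 : (holdIndex P.T K tf : ℕ) = K := holdIndex_eq_last hT hKlt.le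
        have h5 : x₀ (holdIndex P.T K tf) = u K := by rw [hx₀]; simp only; rw [h4]
        have h6 := hx₀R (holdIndex P.T K tf)
        rw [augmentedSystem]
        change h tf ((φ y₀ tf).1, x₀ (holdIndex P.T K tf)) = _
        rw [h5] at h6 ⊢
        rw [hφtf]
        refine heq tf htfb' _ (max_lt ?_ (by change ‖u K‖ < R; linarith))
        change ‖q tf‖ < R
        linarith [hRq tf ⟨htf.le, le_rfl⟩, norm_nonneg x₀]
      have h4 : ((0 : E n), (0 : E n)) = 0 := rfl
      have h5 : ℓ = covector (p tf) c := by
        rw [← hcov tf ⟨htf.le, le_rfl⟩, hΛtf]; rfl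
      rw [h2, h5] at h1
      rw [H_eq_covector, ← smul_eq_mul, ← map_smul, ← h3]
      have h6 : Φ' (0, r) = r • augmentedSystem P.T K h tf (φ y₀ tf) y₀.2 := by
        simp [hΦ']
      rw [h6] at h1
      change inner ℝ ψ (g' ((0 : E n), (0 : E n))) + _ ≤ 0 at h1
      rwa [h4, map_zero, inner_zero_right, zero_add] at h1
    -- A free final time can be moved forwards and backwards, so `H` has both signs and vanishes.
    have h1 := key 1
    have h2 := key (-1)
    linarith

end Problem

end SampledData

theorem theorem1 {n m j : ℕ} (hn : n ≠ 0) (hm : m ≠ 0) (hj : j ≠ 0)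
    (P : SampledData.Problem n m j)
    (hT : 0 < P.T)
    (hf : SampledData.IsC1InStateControl P.f)
    (hf₀ : SampledData.IsC1InStateControl P.f₀)
    (hg : ContDiff ℝ 1 P.g)
    (hΩ_ne : P.Ω.Nonempty) (hΩ_closed : IsClosed P.Ω) (hΩ_convex : Convex ℝ P.Ω)
    (hS_ne : P.S.Nonempty) (hS_closed : IsClosed P.S) (hS_convex : Convex ℝ P.S)
    (tf : ℝ) (u : ℕ → SampledData.E m) (q : ℝ → SampledData.E n)
    (hopt : P.IsOptimal tf u q) :
    ∃ (p : ℝ → SampledData.E n) (p₀ : ℝ),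
      AbsolutelyContinuousOnInterval p 0 tf ∧
      p₀ ≤ 0 ∧
      (p₀ ≠ 0 ∨ ∃ t ∈ Set.Icc 0 tf, p t ≠ 0) ∧
      P.ExtremalEquations tf u q p p₀ ∧
      P.MaximizationCondition tf u q p p₀ ∧
      (P.IsSubmersiveAt (q 0) (q tf) → P.AdjointTransversality tf q p) ∧
      (P.finalTime = SampledData.FinalTime.free → 0 < tf → P.IsC1InTimeNear tf →
        P.H tf (q tf) (p tf) p₀ (u (P.lastIndex tf)) = 0) := by
  have htf0 : 0 ≤ tf := by
    have h := hopt.1.1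
    cases hF : P.finalTime <;> rw [hF] at h
    exacts [h.1, h]
  rcases htf0.eq_or_lt with rfl | htf
  -- When `tf = 0` there are no times and no controlling times to consider, and `p = 0`, `p⁰ = -1`,
  -- `ψ = 0` satisfy everything.
  · refine ⟨fun _ => 0, -1, ?_, by norm_num, Or.inl (by norm_num), by simp [
      SampledData.Problem.ExtremalEquations], fun k hk => ?_, fun _ => ⟨0, ?_, ?_, ?_⟩,
      fun _ h => absurd h (lt_irrefl _)⟩
    · exact (LipschitzWith.const (0 : SampledData.E n)).lipschitzOnWith
        |>.absolutelyContinuousOnInterval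
    · exact absurd hk (not_lt.2 (mul_nonneg (Nat.cast_nonneg k) hT.le))
    · intro s _; simp
    · simp
    · simp
  by_cases hsub : P.IsSubmersiveAt (q 0) (q tf)
  · obtain ⟨p, p₀, ψ, hp, hp₀, hne, hext, hmax, hψ, h0, h1, hH⟩ :=
      SampledData.Problem.exists_extremal_of_surjective hT hf hf₀ hΩ_closed hΩ_convex hg hS_closed
        hS_convex (fun z hz => hz) htf hopt.1.2.2.2 hsub hopt
    have hd : HasFDerivAt P.g (fderiv ℝ P.g (q 0, q tf)) (q 0, q tf) :=
      (hg.differentiable (by simp) _).hasFDerivAt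
    have hd0 : fderiv ℝ (fun x => P.g (x, q tf)) (q 0) = _ :=
      (hd.comp (q 0) (hasFDerivAt_prodMk_left (q 0) (q tf))).fderiv
    have hd1 : fderiv ℝ (fun x => P.g (q 0, x)) (q tf) = _ :=
      (hd.comp (q tf) (hasFDerivAt_prodMk_right (q 0) (q tf))).fderiv
    refine ⟨p, p₀, hp, hp₀, hne, hext, hmax, fun _ => ⟨ψ, hψ, ?_, ?_⟩, fun h _ _ => hH h⟩
    · refine ext_inner_right ℝ fun v => ?_
      rw [h0 v, inner_neg_left, ContinuousLinearMap.adjoint_inner_left, hd0]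
      rfl
    · refine ext_inner_right ℝ fun v => ?_
      rw [h1 v, ContinuousLinearMap.adjoint_inner_left, hd1]
      rfl
  · -- the terminal constraint is replaced by fixed end points, which are always submersive
    -- The pair of end points is read in the `ℓ²` product because the multiplier rule requires an
    -- inner product on the constraint space. Fixing the end points only removes competitors, so
    -- optimality persists.
    set I := (WithLp.prodContinuousLinearEquiv 2 ℝ (SampledData.E n) (SampledData.E n)).symm with hI
    obtain ⟨p, p₀, -, hp, hp₀, hne, hext, hmax, -, -, -, hH⟩ :=
      SampledData.Problem.exists_extremal_of_surjective hT hf hf₀ hΩ_closed hΩ_convex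
        (g := I) I.contDiff (S := {I (q 0, q tf)}) isClosed_singleton (convex_singleton _)
        (fun z hz => by
          rw [I.injective (mem_singleton_iff.1 hz)]
          exact hopt.1.2.2.2) htf rfl
        (by rw [I.fderiv]; exact I.surjective) hopt
    exact ⟨p, p₀, hp, hp₀, hne, hext, hmax, fun h => absurd h hsub, fun h _ _ => hH h⟩
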